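/- Let $\Omega=\{(a,b)\in\mathbb{R}^2 : a,b\in(0,1],\ a+b>1\}$ be the Farey triangle, let $T:\Omega\to\Omega$, $T(a,b)=\left(b,\left\lfloor\frac{1+a}{b}\right\rfloor b-a\right)$, be the BCZ map, and let $dm=2\,da\,db$ be the normalized Lebesgue measure on $\Omega$. For $n\ge 1$ let $0=\rho_0<\rho_1<\dots<\rho_{A_n}=1$ be the Farey sequence of order $n$, i.e. the rationals in $[0,1]$ with reduced denominator at most $n$. An excursion is a finite section $(a_i,b_i)_{i=0}^{s}$, $s\ge 1$, of a $T$-orbit in $\Omega$, that is, $(a_0,b_0)\in\Omega$ and $(a_i,b_i)=T^i(a_0,b_0)$, such that $\frac1{a_m}<\frac1{a_0}$ and $\frac1{a_m}<\frac1{a_s}$ for all $0<m<s$. It corresponds to the pair $(x,y)$ if $a_0=x$ and $a_s=y$. A function $f:\Omega\to\mathbb{R}$ is called piecewise continuous if, up to a Lebesgue null set, $\Omega$ is the union of finitely or countably many pairwise disjoint open sets on each of which $f$ is continuous. Theorem. Let $f:\Omega\to\mathbb{R}$ be bounded and piecewise continuous, and let $p,q\ge 1$ be coprime integers. Then for every $n\ge\max\{p,q\}$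 there is exactly one excursion $e\left(\frac qn,\frac pn\right)$ corresponding to $\left(\frac qn,\frac pn\right)$, the function $f$ is $m$-integrable, and $$\lim_{n\to\infty}\frac{pq}{A_n}\sum_{(a,b)\in e\left(\frac qn,\frac pn\right)}f(a,b)=\int_\Omega f\,dm,$$ where the sum runs over the points $(a_i,b_i)$, $0\le i\le s$, of the excursion. -/

import Mathlib

open MeasureTheory Filter Topology

/-- The Farey triangle `{(a, b) | a, b ∈ (0, 1], a + b > 1}`. -/
def fareyTriangle : Set (ℝ × ℝ) :=
  {x | 0 < x.1 ∧ x.1 ≤ 1 ∧ 0 < x.2 ∧ x.2 ≤ 1 ∧ 1 < x.1 + x.2}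

/-- The BCZ map `T(a, b) = (b, ⌊(1 + a) / b⌋ b - a)`. It is of interest on the Farey triangle,
which it maps to itself. -/
noncomputable def bczMap (x : ℝ × ℝ) : ℝ × ℝ :=
  (x.2, (⌊(1 + x.1) / x.2⌋ : ℝ) * x.2 - x.1)

/-- The probability measure `dm = 2 da db` on the Farey triangle. -/
noncomputable def fareyMeasure : Measure (ℝ × ℝ) :=
  (2 : ENNReal) • (volume : Measure (ℝ × ℝ)).restrict fareyTriangle

/-- The set of the fractions of the Farey sequence `0 = ρ_0 < ρ_1 < ⋯ < ρ_{A_n} = 1`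
of order `n`. -/
def fareySet (n : ℕ) : Set ℚ := {r | 0 ≤ r ∧ r ≤ 1 ∧ r.den ≤ n}

/-- The index `A_n` of the last term of the Farey sequence `(ρ_i)`, `0 ≤ i ≤ A_n`,
of order `n ≥ 1`. -/
noncomputable def fareyIndex (n : ℕ) : ℕ := (fareySet n).ncard - 1

/-- An excursion of the BCZ map: a section `(a_i, b_i) = T^i(a_0, b_0)`, `0 ≤ i ≤ s`, `s ≥ 1`,
of an orbit in the Farey triangle such that both endpoints are deeper than every point strictly
between them, the depth of `(a, b)` being `1 / a`. -/
@[ext]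
structure Excursion where
  /-- the starting point `(a_0, b_0)` -/
  start : ℝ × ℝ
  /-- the number `s` of steps -/
  len : ℕ
  start_mem : start ∈ fareyTriangle
  len_pos : 1 ≤ len
  deeper : ∀ m : ℕ, 0 < m → m < len →
    1 / (bczMap^[m] start).1 < 1 / start.1 ∧
      1 / (bczMap^[m] start).1 < 1 / (bczMap^[len] start).1

namespace Excursion

/-- The `i`-th point `(a_i, b_i)` of the excursion. -/
noncomputable def point (e : Excursion) (i : ℕ) : ℝ × ℝ := bczMap^[i] e.start

/-- The excursion goes from x-coordinate `a` to x-coordinate `b`, i.e. it is the excursion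
corresponding to the point `(a, b)` of `(0, 1]²`. -/
def Corresponds (e : Excursion) (a b : ℝ) : Prop :=
  (e.point 0).1 = a ∧ (e.point e.len).1 = b

/-- The sum of `f` over all the points `(a_i, b_i)`, `0 ≤ i ≤ s`, of the excursion. -/
noncomputable def sum (e : Excursion) (f : ℝ × ℝ → ℝ) : ℝ :=
  ∑ i ∈ Finset.range (e.len + 1), f (e.point i)

end Excursion

/-- `f` is piecewise continuous on the plane set `S`: up to a Lebesgue null set (the boundaries of
the pieces), `S` is the union of finitely or countably many pairwise disjoint open pieces on each
of which `f` is continuous. (Pieces may be empty, so finite families are included.) -/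
def PiecewiseContinuousOn (f : ℝ × ℝ → ℝ) (S : Set (ℝ × ℝ)) : Prop :=
  ∃ P : ℕ → Set (ℝ × ℝ), (∀ i, IsOpen (P i)) ∧ (∀ i, P i ⊆ S) ∧
    (∀ i j, i ≠ j → Disjoint (P i) (P j)) ∧ volume (S \ ⋃ i, P i) = 0 ∧
    ∀ i, ContinuousOn f (P i)

/-!
Let `y q - x p = 1`. The excursion from `q / n` to `p / n` visits the points `(c / n, c' / n)`,
where `c` and `c'` are the denominators of consecutive Farey fractions of order `n` in the interval
`(x / q, y / p]` of length `1 / (p q)`: in an orbit `(U i, W i) / n` consecutive integer vectors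
have determinant one, and since every intermediate first coordinate exceeds both end values, the
two end vectors have determinant one too.

It remains to show that the points `(c / n, c' / n)` equidistribute over any interval. As `c'` is
determined by `n` and by the inverse modulo `c` of the numerator of the fraction, this follows from
the joint equidistribution of `x / c` and `x⁻¹ / c` modulo one over all reduced fractions with
`c ≤ n`: by Weyl's criterion it amounts to cancellation in Kloosterman sums, for which the
elementary fourth moment estimate suffices.
-/

section FiniteRings

open Finset

variable {R : Type*} [CommRing R]

lemma mul_sub_mul_sub_eq_zero {x y z w : Rˣ} (h : (x + y : R) = z + w)
    (h' : (↑x⁻¹ + ↑y⁻¹ : R) = ↑z⁻¹ + ↑w⁻¹) : (x + y : R) * (x - z) * (x - w) = 0 := by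
  have h_prod : (x + y : R) * (z * w) = (z + w) * (x * y) := by
    linear_combination (x * y * z * w : R) * h' - (z * w * y : R) * x.mul_inv
      - (z * w * x : R) * y.mul_inv + (x * y * w : R) * z.mul_inv + (x * y * z : R) * w.mul_inv
  linear_combination h_prod - ((x : R) * y - (x + y) * x) * h

lemma isPrimitive_mul_comp_fst_snd {ψ : AddChar R ℂ} (hψ : ψ.IsPrimitive) :
    (ψ.compAddMonoidHom (AddMonoidHom.fst R R) *
      ψ.compAddMonoidHom (AddMonoidHom.snd R R)).IsPrimitive := by
  rintro ⟨a, b⟩ hab h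
  rw [AddChar.ext_iff] at h
  obtain rfl : a = 0 := by_contra fun ha ↦ hψ ha <| by ext x; simpa using h (x, 0)
  obtain rfl : b = 0 := by_contra fun hb ↦ hψ hb <| by ext x; simpa using h (0, x)
  exact hab rfl

variable [Fintype R] [DecidableEq R]

/-- The number of elements of a finite ring annihilated by `a`. -/
def annCard (a : R) : ℕ := #{s : R | a * s = 0}

lemma card_mul_eq_le_annCard (a b : R) : #{s : R | a * s = b} ≤ annCard a := by
  obtain h | ⟨t, ht⟩ := ({s : R | a * s = b} : Finset R).eq_empty_or_nonempty
  · simp [h]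
  · refine card_le_card_of_injOn (· - t) (fun s hs ↦ ?_) (sub_left_injective.injOn)
    simp only [coe_filter, mem_filter, mem_univ, true_and, Set.mem_ofPred_eq] at hs ht ⊢
    rw [mul_sub, hs, ht, sub_self]

lemma annCard_mul_le (a b : R) : annCard (a * b) ≤ annCard a * annCard b := by
  refine card_le_mul_card_image_of_maps_to (f := (b * ·)) (t := {s : R | a * s = 0}) ?_ _ ?_
    |>.trans_eq (mul_comm _ _)
  · intro s hs
    simpa only [mem_filter_univ, mul_assoc] using hs
  · intro s _
    refine (card_le_card fun t ht ↦ ?_).trans (card_mul_eq_le_annCard b s)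
    simp only [mem_filter, mem_univ, true_and] at ht ⊢
    exact ht.2

lemma card_mul_mul_eq_zero_le :
    #{x : R × R × R | x.1 * x.2.1 * x.2.2 = 0} ≤ (∑ a : R, annCard a) ^ 2 :=
  calc #{x : R × R × R | x.1 * x.2.1 * x.2.2 = 0}
      = ∑ a : R, ∑ b : R, annCard (a * b) := by
        simp only [card_filter, Fintype.sum_prod_type, annCard]
    _ ≤ ∑ a : R, ∑ b : R, annCard a * annCard b := by gcongr; exact annCard_mul_le _ _
    _ = (∑ a : R, annCard a) ^ 2 := by rw [sq, sum_mul_sum]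

variable (R) in
lemma card_add_eq_inv_add_eq_le :
    #{i : (Rˣ × Rˣ) × (Rˣ × Rˣ) | ((i.1.1 + i.1.2 : R), (↑i.1.1⁻¹ + ↑i.1.2⁻¹ : R)) =
      ((i.2.1 + i.2.2 : R), (↑i.2.1⁻¹ + ↑i.2.2⁻¹ : R))} ≤
      annCard (2 : R) * (∑ a : R, annCard a) ^ 2 := by
  refine (card_le_mul_card_image_of_maps_to
    (f := fun i ↦ ((i.1.1 + i.1.2 : R), (i.1.1 - i.2.1 : R), (i.1.1 - i.2.2 : R)))
    (t := {x : R × R × R | x.1 * x.2.1 * x.2.2 = 0}) ?_ (annCard (2 : R)) ?_).trans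
    (Nat.mul_le_mul_left _ card_mul_mul_eq_zero_le)
  · rintro ⟨⟨x, y⟩, ⟨z, w⟩⟩ h
    simp only [mem_filter_univ, Prod.mk.injEq] at h ⊢
    exact mul_sub_mul_sub_eq_zero h.1 h.2
  · rintro ⟨s, a, b⟩ -
    -- On a fibre, `x` satisfies `2 x = s + a + b` and determines `y`, `z` and `w`.
    refine (card_le_card_of_injOn (fun i ↦ (i.1.1 : R)) ?_ ?_).trans
      (card_mul_eq_le_annCard 2 (s + a + b))
    · rintro ⟨⟨x, y⟩, ⟨z, w⟩⟩ h
      simp only [coe_filter, mem_filter, mem_univ, true_and, Prod.mk.injEq,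
        Set.mem_ofPred_eq] at h ⊢
      obtain ⟨⟨h, -⟩, rfl, rfl, rfl⟩ := h
      linear_combination -h
    · rintro ⟨⟨x, y⟩, ⟨z, w⟩⟩ h ⟨⟨x', y'⟩, ⟨z', w'⟩⟩ h' hx
      simp only [coe_filter, mem_filter, mem_univ, true_and, Prod.mk.injEq,
        Set.mem_ofPred_eq] at h h' hx
      obtain ⟨-, rfl, rfl, rfl⟩ := h
      simp only [Prod.mk.injEq, Units.ext_iff]
      exact ⟨⟨hx, by linear_combination -h'.2.1 - hx⟩, by linear_combination h'.2.2.1 + hx,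
        by linear_combination h'.2.2.2 + hx⟩

lemma sum_units_le {F : R × R → ℝ} (hF : 0 ≤ F) (a b : R) :
    ∑ t : Rˣ, F (a * t, b * ↑t⁻¹) ≤ annCard a * ∑ p, F p := by
  classical
  rw [sum_comp F fun t : Rˣ ↦ (a * (t : R), b * (↑t⁻¹ : R)), mul_sum]
  refine (sum_le_sum fun p _ ↦ ?_).trans
    (sum_le_univ_sum_of_nonneg fun p ↦ mul_nonneg (Nat.cast_nonneg _) (hF p))
  rw [nsmul_eq_mul]
  refine mul_le_mul_of_nonneg_right (Nat.cast_le.mpr ?_) (hF p)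
  refine le_trans ?_ (card_mul_eq_le_annCard a p.1)
  refine card_le_card_of_injOn (fun t ↦ (t : R)) (fun t ht ↦ ?_) Units.val_injective.injOn
  simp only [coe_filter, mem_univ, true_and, Set.mem_ofPred_eq] at ht ⊢
  rw [← ht]

lemma sum_norm_sq_mulShift {ψ : AddChar R ℂ} (hψ : ψ.IsPrimitive) {ι : Type*} [Fintype ι]
    (g : ι → R) :
    ∑ a, ‖∑ i, ψ (a * g i)‖ ^ 2 = Fintype.card R * #{i : ι × ι | g i.1 = g i.2} := by
  rw [← Complex.ofReal_inj]
  push_cast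
  calc ∑ a, (‖∑ i, ψ (a * g i)‖ : ℂ) ^ 2
      = ∑ a, ∑ i : ι × ι, ψ (a * (g i.1 - g i.2)) := by
        refine sum_congr rfl fun a _ ↦ ?_
        rw [← Complex.mul_conj', map_sum, sum_mul_sum, Fintype.sum_prod_type]
        simp only [← AddChar.map_neg_eq_conj, ← AddChar.map_add_eq_mul, mul_add, mul_neg,
          sub_eq_add_neg]
    _ = ∑ i : ι × ι, if g i.1 = g i.2 then (Fintype.card R : ℂ) else 0 := by
        rw [sum_comm]
        simp only [AddChar.sum_mulShift _ hψ, sub_eq_zero]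
        push_cast
        rfl
    _ = Fintype.card R * #{i : ι × ι | g i.1 = g i.2} := by
        rw [← sum_filter, sum_const, nsmul_eq_mul, mul_comm]

end FiniteRings

section Residues

open Finset

variable {c : ℕ} [NeZero c] {M : Type*} [AddCommMonoid M]

lemma sum_zmod_eq_sum_Icc (F : ZMod c → M) : ∑ a, F a = ∑ x ∈ Icc 1 c, F x := by
  have h_inj : Set.InjOn (fun x : ℕ ↦ (x : ZMod c)) (Icc 1 c) := by
    intro x hx y hy hxy
    simp only [coe_Icc, Set.mem_Icc] at hx hy
    exact ((ZMod.natCast_eq_natCast_iff x y c).mp hxy).eq_of_abs_lt (by rw [abs_lt]; omega)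
  have h_image : (Icc 1 c).image (fun x : ℕ ↦ (x : ZMod c)) = univ :=
    eq_univ_of_card _ (by rw [card_image_of_injOn h_inj]; simp)
  rw [← sum_image h_inj, h_image]

lemma sum_units_zmod_eq_sum_Icc (F : ZMod c → M) :
    ∑ u : (ZMod c)ˣ, F u = ∑ x ∈ Icc 1 c with x.Coprime c, F x :=
  calc ∑ u : (ZMod c)ˣ, F u = ∑ a with IsUnit a, F a := by
        refine sum_bij (fun u _ ↦ (u : ZMod c)) ?_ ?_ ?_ ?_
        · simp
        · simp [Units.ext_iff]
        · exact fun a ha ↦ ⟨(mem_filter_univ a |>.mp ha).unit, mem_univ _, rfl⟩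
        · simp
    _ = ∑ x ∈ Icc 1 c with x.Coprime c, F x := by
        simp only [sum_filter, sum_zmod_eq_sum_Icc, ZMod.isUnit_iff_coprime]

lemma annCard_zmod_le_gcd (x : ℕ) : annCard (x : ZMod c) ≤ x.gcd c := by
  have h_mul : ∀ s : ZMod c, (x : ZMod c) * s = 0 → x.gcd c • s = 0 := fun s hs ↦ by
    have h_bezout : (x.gcd c : ZMod c) = x * (x.gcdA c : ZMod c) := by
      simpa using congrArg (Int.cast : ℤ → ZMod c) (x.gcd_eq_gcd_ab c)
    rw [nsmul_eq_mul, h_bezout, mul_right_comm, hs, zero_mul]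
  exact (card_le_card (monotone_filter_right _ fun s _ ↦ h_mul s)).trans
    (IsAddCyclic.card_nsmul_eq_zero_le (Nat.gcd_pos_of_pos_right _ (NeZero.pos c)))

lemma annCard_intCast_le {h : ℤ} (hh : h ≠ 0) : annCard (h : ZMod c) ≤ h.natAbs := by
  have h_mul : ∀ s : ZMod c, (h : ZMod c) * s = 0 → h.natAbs • s = 0 := fun s hs ↦ by
    rw [← natCast_zsmul, Int.natCast_natAbs]
    obtain h_abs | h_abs := abs_choice h <;> simp [h_abs, zsmul_eq_mul, hs]
  exact (card_le_card (monotone_filter_right _ fun s _ ↦ h_mul s)).trans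
    (IsAddCyclic.card_nsmul_eq_zero_le (Int.natAbs_pos.mpr hh))

variable (c) in
lemma sum_annCard_zmod_le : ∑ a : ZMod c, annCard a ≤ c * #c.divisors :=
  calc ∑ a : ZMod c, annCard a ≤ ∑ x ∈ Icc 1 c, x.gcd c := by
        rw [sum_zmod_eq_sum_Icc]
        exact sum_le_sum fun x _ ↦ annCard_zmod_le_gcd x
    _ ≤ ∑ x ∈ Icc 1 c, ∑ d ∈ c.divisors with d ∣ x, d := by
        refine sum_le_sum fun x _ ↦ single_le_sum (f := id) (fun _ _ ↦ Nat.zero_le _) ?_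
        simp [Nat.gcd_dvd_left, Nat.gcd_dvd_right, NeZero.ne c]
    _ = ∑ d ∈ c.divisors, c / d * d := by
        simp_rw [sum_filter]
        rw [sum_comm]
        refine sum_congr rfl fun d _ ↦ ?_
        rw [← sum_filter, sum_const, smul_eq_mul, ← Nat.Ioc_filter_dvd_card_eq_div]
        rfl
    _ = c * #c.divisors := by
        rw [sum_congr rfl fun d hd ↦ Nat.div_mul_cancel (Nat.dvd_of_mem_divisors hd), sum_const,
          smul_eq_mul, mul_comm]

end Residues

section Kloosterman

open Finset

/-- The Kloosterman sum `K_c(a, b) = ∑ e((a x + b x⁻¹) / c)` over the units `x` modulo `c`. -/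
noncomputable def kloosterman (c : ℕ) [NeZero c] (a b : ZMod c) : ℂ :=
  ∑ x : (ZMod c)ˣ, ZMod.stdAddChar (N := c) (a * x + b * ↑x⁻¹)

variable {c : ℕ} [NeZero c]

lemma kloosterman_mul_unit (a b : ZMod c) (t : (ZMod c)ˣ) :
    kloosterman c (a * t) (b * ↑t⁻¹) = kloosterman c a b := by
  refine Fintype.sum_equiv (Equiv.mulLeft t) _ _ fun x ↦ ?_
  simp only [Equiv.coe_mulLeft, mul_inv_rev, Units.val_mul]
  congr 1; ring

lemma kloosterman_comm (a b : ZMod c) : kloosterman c a b = kloosterman c b a := by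
  refine Fintype.sum_equiv (Equiv.inv _) _ _ fun x ↦ ?_
  simp only [Equiv.inv_apply, inv_inv, add_comm]

lemma kloosterman_sq (a b : ZMod c) :
    kloosterman c a b ^ 2 = ∑ i : (ZMod c)ˣ × (ZMod c)ˣ,
      ZMod.stdAddChar (N := c) (a * (i.1 + i.2) + b * (↑i.1⁻¹ + ↑i.2⁻¹)) := by
  rw [kloosterman, sq, sum_mul_sum, Fintype.sum_prod_type]
  refine sum_congr rfl fun i _ ↦ sum_congr rfl fun j _ ↦ ?_
  rw [← AddChar.map_add_eq_mul]
  congr 1; ring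

lemma sum_norm_kloosterman_pow_four (c : ℕ) [NeZero c] :
    ∑ a : ZMod c × ZMod c, ‖kloosterman c a.1 a.2‖ ^ 4 = (c : ℝ) ^ 2 *
      #{i : ((ZMod c)ˣ × (ZMod c)ˣ) × ((ZMod c)ˣ × (ZMod c)ˣ) |
        ((i.1.1 + i.1.2 : ZMod c), (↑i.1.1⁻¹ + ↑i.1.2⁻¹ : ZMod c)) =
          ((i.2.1 + i.2.2 : ZMod c), (↑i.2.1⁻¹ + ↑i.2.2⁻¹ : ZMod c))} := by
  have h := sum_norm_sq_mulShift
    (isPrimitive_mul_comp_fst_snd (ZMod.isPrimitive_stdAddChar c))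
    (fun i : (ZMod c)ˣ × (ZMod c)ˣ ↦ ((i.1 + i.2 : ZMod c), (↑i.1⁻¹ + ↑i.2⁻¹ : ZMod c)))
  simp only [AddChar.mul_apply, AddChar.compAddMonoidHom_apply, AddMonoidHom.coe_fst,
    AddMonoidHom.coe_snd, Prod.fst_mul, Prod.snd_mul, ← AddChar.map_add_eq_mul,
    ← kloosterman_sq, norm_pow, ← pow_mul, Nat.reduceMul] at h
  rw [h, Fintype.card_prod, ZMod.card, Nat.cast_mul, sq]

lemma sum_norm_kloosterman_pow_four_le (c : ℕ) [NeZero c] :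
    ∑ a : ZMod c × ZMod c, ‖kloosterman c a.1 a.2‖ ^ 4 ≤ 2 * (c : ℝ) ^ 4 * #c.divisors ^ 2 := by
  have h_two : annCard (2 : ZMod c) ≤ 2 := by simpa using annCard_intCast_le (c := c) two_ne_zero
  have h_count := (card_add_eq_inv_add_eq_le (ZMod c)).trans
    (Nat.mul_le_mul h_two (Nat.pow_le_pow_left (sum_annCard_zmod_le c) 2))
  rw [sum_norm_kloosterman_pow_four]
  calc _ ≤ (c : ℝ) ^ 2 * (2 * (c * #c.divisors) ^ 2 : ℕ) := by gcongr
    _ = 2 * (c : ℝ) ^ 4 * #c.divisors ^ 2 := by push_cast; ring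

lemma le_totient_mul_card_divisors (c : ℕ) : c ≤ c.totient * #c.divisors := by
  obtain rfl | hc := c.eq_zero_or_pos
  · simp
  calc c = ∑ d ∈ c.divisors, d.totient := c.sum_totient.symm
    _ ≤ #c.divisors * c.totient := by
      refine sum_le_card_nsmul _ _ _ fun d hd ↦ Nat.le_of_dvd (Nat.totient_pos.mpr hc) ?_
      exact Nat.totient_dvd_of_dvd (Nat.dvd_of_mem_divisors hd)
    _ = c.totient * #c.divisors := mul_comm _ _

lemma norm_kloosterman_pow_four_le (a b : ZMod c) :
    ‖kloosterman c a b‖ ^ 4 ≤ 2 * annCard a * (c : ℝ) ^ 3 * #c.divisors ^ 3 := by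
  -- `K_c(a, b)` recurs `φ(c)` times in the fourth moment, at the points `(a t, b t⁻¹)`.
  have h_orbit : c.totient * ‖kloosterman c a b‖ ^ 4 ≤
      annCard a * (2 * (c : ℝ) ^ 4 * #c.divisors ^ 2) := by
    have h := sum_units_le (F := fun p : ZMod c × ZMod c ↦ ‖kloosterman c p.1 p.2‖ ^ 4)
      (fun _ ↦ by positivity) a b
    simp only [kloosterman_mul_unit, sum_const, card_univ, ZMod.card_units_eq_totient,
      nsmul_eq_mul] at h
    exact h.trans (by gcongr; exact sum_norm_kloosterman_pow_four_le c)
  have h_totient : (c : ℝ) ≤ c.totient * #c.divisors := mod_cast le_totient_mul_card_divisors c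
  refine le_of_mul_le_mul_left ?_ (Nat.cast_pos.mpr (NeZero.pos c))
  calc (c : ℝ) * ‖kloosterman c a b‖ ^ 4
      ≤ (c.totient * #c.divisors) * ‖kloosterman c a b‖ ^ 4 := by gcongr
    _ = #c.divisors * (c.totient * ‖kloosterman c a b‖ ^ 4) := by ring
    _ ≤ #c.divisors * (annCard a * (2 * (c : ℝ) ^ 4 * #c.divisors ^ 2)) := by gcongr
    _ = c * (2 * annCard a * (c : ℝ) ^ 3 * #c.divisors ^ 3) := by ring

lemma norm_kloosterman_pow_four_le_of_ne_zero {h k : ℤ} (hhk : h ≠ 0 ∨ k ≠ 0) :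
    ‖kloosterman c h k‖ ^ 4 ≤
      2 * (h.natAbs + k.natAbs : ℕ) * (c : ℝ) ^ 3 * #c.divisors ^ 3 := by
  wlog hh : h ≠ 0 generalizing h k
  · rw [kloosterman_comm, add_comm h.natAbs]
    exact this hhk.symm (hhk.resolve_left hh)
  refine (norm_kloosterman_pow_four_le _ _).trans ?_
  gcongr
  exact (annCard_intCast_le hh).trans (Nat.le_add_right _ _)

lemma norm_kloosterman_le {N : ℕ} (hcN : c ≤ N) {h k : ℤ} (hhk : h ≠ 0 ∨ k ≠ 0) :
    ‖kloosterman c h k‖ ≤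
      2 * (h.natAbs + k.natAbs : ℕ) * ((N : ℝ) ^ (3 / 4 : ℝ) * #c.divisors) := by
  have h_coeff : (1 : ℝ) ≤ 2 * (h.natAbs + k.natAbs : ℕ) := by
    norm_cast
    obtain hh | hk := hhk <;> omega
  have h_divisors : (1 : ℝ) ≤ #c.divisors :=
    mod_cast card_pos.mpr ⟨1, Nat.one_mem_divisors.mpr (NeZero.ne c)⟩
  have h_pow : ((N : ℝ) ^ (3 / 4 : ℝ)) ^ 4 = (N : ℝ) ^ 3 := by
    rw [← Real.rpow_mul_natCast (by positivity), ← Real.rpow_natCast]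
    norm_num
  refine le_of_pow_le_pow_left₀ four_ne_zero (by positivity) ?_
  refine (norm_kloosterman_pow_four_le_of_ne_zero hhk).trans ?_
  rw [mul_pow, mul_pow _ (#c.divisors : ℝ), h_pow, mul_assoc]
  gcongr
  · exact le_self_pow₀ h_coeff four_ne_zero
  · norm_num

lemma sum_card_divisors_le (N : ℕ) :
    ∑ c ∈ Icc 1 N, (#c.divisors : ℝ) ≤ N * (1 + Real.log N) :=
  calc ∑ c ∈ Icc 1 N, (#c.divisors : ℝ) = ∑ c ∈ Icc 1 N, (#{d ∈ Icc 1 N | d ∣ c} : ℝ) := by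
        refine sum_congr rfl fun c hc ↦ congrArg _ (congrArg _ (ext fun d ↦ ?_))
        simp only [mem_Icc, Nat.mem_divisors, mem_filter] at hc ⊢
        refine ⟨fun h ↦ ⟨⟨Nat.pos_of_dvd_of_pos h.1 hc.1, (Nat.le_of_dvd hc.1 h.1).trans hc.2⟩,
          h.1⟩, fun h ↦ ⟨h.2, by omega⟩⟩
    _ = ∑ d ∈ Icc 1 N, (#{c ∈ Ioc 0 N | d ∣ c} : ℝ) := by
        exact_mod_cast sum_card_bipartiteAbove_eq_sum_card_bipartiteBelow (fun c d ↦ d ∣ c)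
    _ ≤ ∑ d ∈ Icc 1 N, (N : ℝ) * (d : ℝ)⁻¹ := by
        refine sum_le_sum fun d _ ↦ ?_
        rw [Nat.Ioc_filter_dvd_card_eq_div, ← div_eq_mul_inv]
        exact Nat.cast_div_le
    _ = N * (harmonic N : ℝ) := by rw [← mul_sum, harmonic_eq_sum_Icc]; push_cast; rfl
    _ ≤ N * (1 + Real.log N) := by gcongr; exact harmonic_le_one_add_log N

lemma tendsto_sum_rpow_mul_card_divisors :
    Tendsto (fun N : ℕ ↦ (∑ c ∈ Icc 1 N, (N : ℝ) ^ (3 / 4 : ℝ) * #c.divisors) / (N : ℝ) ^ 2)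
      atTop (𝓝 0) := by
  have h_lim : Tendsto (fun x : ℝ ↦ x ^ (-(1 / 4) : ℝ) + Real.log x / x ^ (1 / 4 : ℝ))
      atTop (𝓝 0) := by
    simpa using (tendsto_rpow_neg_atTop (by norm_num : (0 : ℝ) < 1 / 4)).add
      (isLittleO_log_rpow_atTop (by norm_num : (0 : ℝ) < 1 / 4)).tendsto_div_nhds_zero
  refine squeeze_zero' (Eventually.of_forall fun N ↦ by positivity) ?_
    (h_lim.comp tendsto_natCast_atTop_atTop)
  filter_upwards [eventually_gt_atTop 0] with N hN
  have hN : (0 : ℝ) < N := Nat.cast_pos.mpr hN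
  have h_split : (N : ℝ) ^ (3 / 4 : ℝ) * N = N ^ 2 * (N : ℝ) ^ (-(1 / 4) : ℝ) := by
    rw [← Real.rpow_natCast, ← Real.rpow_add hN, ← Real.rpow_add_one hN.ne']
    norm_num
  rw [← mul_sum, Function.comp_apply, div_le_iff₀ (by positivity)]
  calc (N : ℝ) ^ (3 / 4 : ℝ) * ∑ c ∈ Icc 1 N, (#c.divisors : ℝ)
      ≤ (N : ℝ) ^ (3 / 4 : ℝ) * (N * (1 + Real.log N)) := by gcongr; exact sum_card_divisors_le N
    _ = _ := by
      rw [div_eq_mul_inv (Real.log N), ← Real.rpow_neg hN.le]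
      linear_combination (1 + Real.log N) * h_split

end Kloosterman

section TotientSum

open Finset

open ArithmeticFunction (moebius)

lemma hasSum_moebius_div_sq :
    HasSum (fun d : ℕ ↦ (moebius d : ℝ) / (d : ℝ) ^ 2) (6 / Real.pi ^ 2) := by
  have h_two : (1 : ℝ) < (2 : ℂ).re := by norm_num
  have h_value : LSeries (fun n ↦ (moebius n : ℂ)) 2 = ((6 / Real.pi ^ 2 : ℝ) : ℂ) := by
    have h := ArithmeticFunction.LSeries_zeta_mul_Lseries_moebius h_two
    rw [ArithmeticFunction.LSeries_zeta_eq_riemannZeta h_two, riemannZeta_two] at h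
    rw [eq_one_div_of_mul_eq_one_right h, one_div_div]
    push_cast
    rfl
  have h := (ArithmeticFunction.LSeriesSummable_moebius_iff.mpr h_two).LSeriesHasSum
  rw [h_value] at h
  refine Complex.hasSum_ofReal.mp (h.congr_fun fun d ↦ ?_)
  obtain rfl | hd := eq_or_ne d 0
  · simp
  · simp [LSeries.term_of_ne_zero hd]

lemma sum_totient_eq_tsum (N : ℕ) :
    ∑ c ∈ Icc 1 N, (c.totient : ℝ) = ∑' d : ℕ, (moebius d : ℝ) * ((N / d + 1).choose 2 : ℕ) := by
  have h_totient : ∀ n ∈ Ioc 0 N, (n.totient : ℝ) =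
      ((moebius : ArithmeticFunction ℝ) * (ArithmeticFunction.id : ArithmeticFunction ℝ)) n := by
    intro n hn
    rw [← (ArithmeticFunction.sum_eq_iff_sum_mul_moebius_eq (f := fun n ↦ (n.totient : ℝ))
      (g := fun n ↦ (n : ℝ))).mp (fun n _ ↦ mod_cast n.sum_totient) n (mem_Ioc.mp hn).1,
      ArithmeticFunction.mul_apply]
    simp
  have h_gauss (m : ℕ) : ∑ k ∈ Ioc 0 m, k = (m + 1).choose 2 := by
    rw [Nat.choose_two_right, ← sum_range_id, sum_range_eq_add_Ico _ m.succ_pos, zero_add]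
    rfl
  calc ∑ c ∈ Icc 1 N, (c.totient : ℝ)
      = ∑ d ∈ Ioc 0 N, (moebius d : ℝ) * ((N / d + 1).choose 2 : ℕ) := by
        refine (sum_congr rfl h_totient).trans ?_
        rw [ArithmeticFunction.sum_Ioc_mul_eq_sum_sum]
        simp [← h_gauss]
    _ = _ := by
        refine (tsum_eq_sum fun d hd ↦ ?_).symm
        rw [mem_Ioc, not_and_or] at hd
        obtain hd | hd := hd
        · simp [show d = 0 by omega]
        · simp [Nat.div_eq_of_lt (not_le.mp hd)]

lemma tendsto_choose_two_div_sq (d : ℕ) :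
    Tendsto (fun N : ℕ ↦ ((N / d + 1).choose 2 : ℝ) / (N : ℝ) ^ 2) atTop
      (𝓝 (2⁻¹ / (d : ℝ) ^ 2)) := by
  obtain rfl | hd := eq_or_ne d 0
  · simp
  have h_floor : Tendsto (fun N : ℕ ↦ ((N / d : ℕ) : ℝ) / N) atTop (𝓝 (d : ℝ)⁻¹) := by
    refine ((tendsto_nat_floor_mul_div_atTop (R := ℝ) (a := (d : ℝ)⁻¹) (by positivity)).comp
      tendsto_natCast_atTop_atTop).congr fun N ↦ ?_
    simp only [Function.comp_apply, inv_mul_eq_div, Nat.floor_div_eq_div]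
  have h_lim := (h_floor.mul (h_floor.add tendsto_one_div_atTop_nhds_zero_nat)).mul_const 2⁻¹
  rw [add_zero, ← sq, inv_pow, inv_mul_eq_div] at h_lim
  refine h_lim.congr' ?_
  filter_upwards [eventually_ne_atTop 0] with N hN
  rw [Nat.cast_choose_two]
  push_cast
  field_simp
  ring

lemma choose_two_div_sq_le (N d : ℕ) :
    ((N / d + 1).choose 2 : ℝ) / (N : ℝ) ^ 2 ≤ 1 / (d : ℝ) ^ 2 := by
  have h_choose : (N / d + 1).choose 2 ≤ (N / d) ^ 2 := by
    rw [Nat.choose_two_right, Nat.add_sub_cancel]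
    refine Nat.div_le_of_le_mul ?_
    obtain h | h := (N / d).eq_zero_or_pos
    · simp [h]
    · nlinarith
  obtain rfl | hN := N.eq_zero_or_pos
  · simp
  rw [div_le_iff₀ (by positivity)]
  calc ((N / d + 1).choose 2 : ℝ) ≤ ((N / d : ℕ) : ℝ) ^ 2 := mod_cast h_choose
    _ ≤ ((N : ℝ) / d) ^ 2 := by gcongr; exact Nat.cast_div_le
    _ = 1 / (d : ℝ) ^ 2 * N ^ 2 := by ring

lemma tendsto_sum_totient_div_sq :
    Tendsto (fun N : ℕ ↦ (∑ c ∈ Icc 1 N, (c.totient : ℝ)) / (N : ℝ) ^ 2) atTop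
      (𝓝 (3 / Real.pi ^ 2)) := by
  have h_value : 3 / Real.pi ^ 2 = ∑' d : ℕ, (moebius d : ℝ) * (2⁻¹ / (d : ℝ) ^ 2) := by
    rw [tsum_congr fun d ↦ mul_div_left_comm (moebius d : ℝ) 2⁻¹ ((d : ℝ) ^ 2), tsum_mul_left,
      hasSum_moebius_div_sq.tsum_eq]
    ring
  rw [h_value]
  simp_rw [sum_totient_eq_tsum, ← tsum_div_const, mul_div_assoc]
  refine tendsto_tsum_of_dominated_convergence hasSum_zeta_two.summable
    (fun d ↦ (tendsto_choose_two_div_sq d).const_mul _) (Eventually.of_forall fun N d ↦ ?_)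
  rw [norm_mul, Real.norm_of_nonneg (r := _ / _) (by positivity)]
  refine (mul_le_of_le_one_left (by positivity) ?_).trans (choose_two_div_sq_le N d)
  rw [Real.norm_eq_abs]
  exact_mod_cast ArithmeticFunction.abs_moebius_le_one

end TotientSum

section WeakConvergence

open scoped BoundedContinuousFunction

variable {X Y ι : Type*} [MeasurableSpace X] [TopologicalSpace X] [OpensMeasurableSpace X]
  [HasOuterApproxClosed X] {l : Filter ι} {μs : ι → ProbabilityMeasure X}
  {μ : ProbabilityMeasure X} {U : Set X}

lemma tendsto_map_of_continuousOn [MeasurableSpace Y] [TopologicalSpace Y] [BorelSpace Y]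
    [l.IsCountablyGenerated] (h : Tendsto μs l (𝓝 μ)) {g : X → Y} (hg : Measurable g)
    (hgU : ContinuousOn g U) (hU : IsOpen U) (hμU : (μ : Measure X) Uᶜ = 0) :
    Tendsto (fun i ↦ (μs i).map hg.aemeasurable) l (𝓝 (μ.map hg.aemeasurable)) := by
  refine tendsto_of_forall_isOpen_le_liminf' fun G hG ↦ ?_
  simp only [ProbabilityMeasure.toMeasure_map, Measure.map_apply hg hG.measurableSet]
  calc (μ : Measure X) (g ⁻¹' G) = (μ : Measure X) (U ∩ g ⁻¹' G) := by
        rw [Set.inter_comm, measure_inter_conull hμU]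
    _ ≤ l.liminf fun i ↦ (μs i : Measure X) (U ∩ g ⁻¹' G) :=
        ProbabilityMeasure.le_liminf_measure_open_of_tendsto h (hgU.isOpen_inter_preimage hU hG)
    _ ≤ l.liminf fun i ↦ (μs i : Measure X) (g ⁻¹' G) :=
        liminf_le_liminf (Eventually.of_forall fun i ↦ measure_mono Set.inter_subset_right)

lemma tendsto_integral_of_bounded_of_measurable_of_continuousOn [l.IsCountablyGenerated]
    (h : Tendsto μs l (𝓝 μ)) {g : X → ℝ} {C : ℝ} (hC : ∀ x, |g x| ≤ C) (hg : Measurable g)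
    (hgU : ContinuousOn g U) (hU : IsOpen U) (hμU : (μ : Measure X) Uᶜ = 0) :
    Tendsto (fun i ↦ ∫ x, g x ∂(μs i : Measure X)) l (𝓝 (∫ x, g x ∂(μ : Measure X))) := by
  let clamp : ℝ →ᵇ ℝ := .ofNormedAddCommGroup (fun y ↦ max (-C) (min C y)) (by fun_prop) |C|
    fun y ↦ abs_le.mpr ⟨by grind, by grind⟩
  have hclamp (x : X) : clamp (g x) = g x := by
    simpa [clamp] using by rw [min_eq_right (abs_le.mp (hC x)).2, max_eq_right (abs_le.mp (hC x)).1]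
  have hmap (ν : ProbabilityMeasure X) :
      ∫ y, clamp y ∂(ν.map hg.aemeasurable : Measure ℝ) = ∫ x, g x ∂(ν : Measure X) := by
    rw [ProbabilityMeasure.toMeasure_map, integral_map hg.aemeasurable
      clamp.continuous.aestronglyMeasurable]
    simp only [hclamp]
  simpa only [hmap] using ProbabilityMeasure.tendsto_iff_forall_integral_tendsto.mp
    (tendsto_map_of_continuousOn h hg hgU hU hμU) clamp

lemma tendsto_integral_of_bounded_of_continuousOn [l.IsCountablyGenerated]
    (h : Tendsto μs l (𝓝 μ)) {f : X → ℝ} {C : ℝ} (hC : ∀ x, |f x| ≤ C)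
    (hf : ∀ᶠ i in l, AEStronglyMeasurable f (μs i : Measure X)) (hfU : ContinuousOn f U)
    (hU : IsOpen U) (hμU : (μ : Measure X) Uᶜ = 0) :
    Tendsto (fun i ↦ ∫ x, f x ∂(μs i : Measure X)) l (𝓝 (∫ x, f x ∂(μ : Measure X))) := by
  classical
  have hmeas : Measurable (U.indicator f) := by
    rw [← Set.piecewise_eq_indicator]
    exact hfU.measurable_piecewise continuousOn_const hU.measurableSet
  have hlim : Tendsto (fun i ↦ ∫ x, U.indicator f x ∂(μs i : Measure X)) l
      (𝓝 (∫ x, f x ∂(μ : Measure X))) := by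
    have hae : U.indicator f =ᵐ[(μ : Measure X)] f := by
      filter_upwards [mem_ae_iff.mpr hμU] with x hx using Set.indicator_of_mem hx f
    rw [← integral_congr_ae hae]
    refine tendsto_integral_of_bounded_of_measurable_of_continuousOn (C := C) h (fun x ↦ ?_) hmeas
      (hfU.congr fun x hx ↦ Set.indicator_of_mem hx f) hU hμU
    exact (norm_indicator_le_norm_self f x).trans (hC x)
  have hcompl : Tendsto (fun i ↦ C * (μs i : Measure X).real Uᶜ) l (𝓝 0) := by
    have h0 := ProbabilityMeasure.tendsto_measure_of_null_frontier_of_tendsto' h (E := Uᶜ)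
      (measure_mono_null hU.isClosed_compl.frontier_subset hμU)
    rw [hμU] at h0
    have h1 : Tendsto (fun i ↦ (μs i : Measure X).real Uᶜ) l (𝓝 0) :=
      (ENNReal.tendsto_toReal ENNReal.zero_ne_top).comp h0
    simpa only [mul_zero] using h1.const_mul C
  have herr : Tendsto (fun i ↦ ∫ x, Uᶜ.indicator f x ∂(μs i : Measure X)) l (𝓝 0) := by
    refine squeeze_zero_norm (fun i ↦ ?_) hcompl
    rw [integral_indicator hU.measurableSet.compl]
    exact norm_setIntegral_le_of_norm_le_const (measure_lt_top _ _) fun x _ ↦ hC x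
  rw [← add_zero (∫ x, f x ∂(μ : Measure X))]
  refine (hlim.add herr).congr' ?_
  filter_upwards [hf] with i hi
  rw [integral_indicator hU.measurableSet, integral_indicator hU.measurableSet.compl,
    integral_add_compl hU.measurableSet (.of_bound hi C (.of_forall hC))]

end WeakConvergence

section DenseSpan

variable {X ι : Type*} [TopologicalSpace X] [CompactSpace X] [MeasurableSpace X]
  [OpensMeasurableSpace X] {l : Filter ι} {μs : ι → ProbabilityMeasure X} {μ : ProbabilityMeasure X}

lemma integrable_continuousMap (ν : Measure X) [IsFiniteMeasure ν] (f : C(X, ℂ)) :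
    Integrable f ν :=
  (BoundedContinuousFunction.mkOfCompact f).integrable ν

lemma lipschitzWith_integral_continuousMap (ν : ProbabilityMeasure X) :
    LipschitzWith 1 fun f : C(X, ℂ) ↦ ∫ x, f x ∂(ν : Measure X) := by
  refine LipschitzWith.mk_one fun f g ↦ ?_
  rw [dist_eq_norm, ← integral_sub (integrable_continuousMap _ f) (integrable_continuousMap _ g)]
  simpa [dist_eq_norm] using norm_integral_le_of_norm_le_const (μ := (ν : Measure X))
    (.of_forall fun x ↦ (f - g).norm_coe_le_norm x)

lemma isClosed_setOf_tendsto_integral :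
    IsClosed {f : C(X, ℂ) | Tendsto (fun i ↦ ∫ x, f x ∂(μs i : Measure X)) l
      (𝓝 (∫ x, f x ∂(μ : Measure X)))} :=
  (LipschitzWith.uniformEquicontinuous _ 1
    fun i ↦ lipschitzWith_integral_continuousMap (μs i)).equicontinuous.isClosed_setOfPred_tendsto
    (lipschitzWith_integral_continuousMap μ).continuous

lemma tendsto_of_topologicalClosure_span_eq_top {S : Set C(X, ℂ)}
    (hS : (Submodule.span ℂ S).topologicalClosure = ⊤)
    (h : ∀ f ∈ S, Tendsto (fun i ↦ ∫ x, f x ∂(μs i : Measure X)) l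
      (𝓝 (∫ x, f x ∂(μ : Measure X)))) :
    Tendsto μs l (𝓝 μ) := by
  have hspan : (Submodule.span ℂ S : Set C(X, ℂ)) ⊆ {f : C(X, ℂ) |
      Tendsto (fun i ↦ ∫ x, f x ∂(μs i : Measure X)) l (𝓝 (∫ x, f x ∂(μ : Measure X)))} := by
    intro f hf
    induction hf using Submodule.span_induction with
    | mem f hf => exact h f hf
    | zero => simpa using tendsto_const_nhds
    | add f g _ _ hf hg =>
      simpa [integral_add (integrable_continuousMap _ f) (integrable_continuousMap _ g)]
        using hf.add hg
    | smul a f _ hf => simpa [integral_const_mul] using hf.const_mul a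
  refine (ProbabilityMeasure.tendsto_iff_forall_integral_rclike_tendsto ℂ).mpr fun f ↦ ?_
  have hf : f.toContinuousMap ∈ (Submodule.span ℂ S).topologicalClosure := hS ▸ trivial
  exact isClosed_setOf_tendsto_integral.closure_subset_iff.mpr hspan hf

end DenseSpan

section Torus

instance : IsProbabilityMeasure (volume : Measure UnitAddCircle) := ⟨by simp⟩

lemma integral_mFourier_of_ne_zero {d : Type*} [Fintype d] {n : d → ℤ} (hn : n ≠ 0) :
    ∫ x, UnitAddTorus.mFourier n x = 0 := by
  obtain ⟨i, hi⟩ := Function.ne_iff.mp hn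
  refine (integral_fintype_prod_volume_eq_prod fun i ↦ ⇑(fourier (T := 1) (n i))).trans ?_
  refine Finset.prod_eq_zero (Finset.mem_univ i) ?_
  exact integral_eq_zero_of_add_right_eq_neg (fourier_add_half_inv_index hi one_pos)

lemma tendsto_volume_of_tendsto_integral_mFourier {d ι : Type*} [Fintype d] {l : Filter ι}
    {μs : ι → ProbabilityMeasure (UnitAddTorus d)}
    (h : ∀ n : d → ℤ, n ≠ 0 →
      Tendsto (fun i ↦ ∫ x, UnitAddTorus.mFourier n x ∂(μs i : Measure (UnitAddTorus d))) l (𝓝 0)) :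
    Tendsto μs l (𝓝 ⟨volume, inferInstance⟩) := by
  refine tendsto_of_topologicalClosure_span_eq_top UnitAddTorus.span_mFourier_closure_eq_top ?_
  rintro _ ⟨n, rfl⟩
  rcases eq_or_ne n 0 with rfl | hn
  · simpa [UnitAddTorus.mFourier_zero] using tendsto_const_nhds
  · simpa only [ProbabilityMeasure.coe_mk, integral_mFourier_of_ne_zero hn] using h n hn

end Torus

section Empirical

open scoped Finset

variable {ι X Y : Type*} [MeasurableSpace X] [MeasurableSpace Y]

/-- The uniform probability measure on the points `g i`, `i ∈ s`, counted with multiplicity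
(with a junk value for `s = ∅`). -/
noncomputable def empiricalMeasure [Nonempty X] (s : Finset ι) (g : ι → X) : ProbabilityMeasure X :=
  FiniteMeasure.normalize ⟨∑ i ∈ s, Measure.dirac (g i), inferInstance⟩

variable {s : Finset ι} {g : ι → X}

lemma toMeasure_empiricalMeasure [Nonempty X] (hs : s.Nonempty) :
    (empiricalMeasure s g : Measure X) = (#s : ENNReal)⁻¹ • ∑ i ∈ s, Measure.dirac (g i) := by
  set ν : FiniteMeasure X := ⟨∑ i ∈ s, Measure.dirac (g i), inferInstance⟩ with hν
  have hmass : ν.mass = #s := by simp [FiniteMeasure.mass, hν]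
  have hne : ν ≠ 0 := by
    rw [← ν.mass_nonzero_iff, hmass]
    exact_mod_cast hs.card_pos.ne'
  rw [empiricalMeasure, ← hν, ν.toMeasure_normalize_eq_of_nonzero hne, hmass, ← ENNReal.coe_natCast,
    ← ENNReal.coe_inv (by exact_mod_cast hs.card_pos.ne')]
  rfl

lemma empiricalMeasure_apply [Nonempty X] (hs : s.Nonempty) {E : Set X} [DecidablePred (g · ∈ E)]
    (hE : MeasurableSet E) :
    (empiricalMeasure s g : Measure X).real E = #{i ∈ s | g i ∈ E} / #s := by
  rw [measureReal_def, toMeasure_empiricalMeasure hs]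
  simp [hE, Set.indicator_apply, div_eq_inv_mul]

lemma map_empiricalMeasure [Nonempty X] [Nonempty Y] (hs : s.Nonempty) {φ : X → Y}
    (hφ : Measurable φ) :
    (empiricalMeasure s g).map hφ.aemeasurable = empiricalMeasure s (φ ∘ g) := by
  refine Subtype.ext ?_
  rw [ProbabilityMeasure.val_eq_to_measure, ProbabilityMeasure.val_eq_to_measure,
    ProbabilityMeasure.toMeasure_map, toMeasure_empiricalMeasure hs,
    toMeasure_empiricalMeasure hs, Measure.map_smul, Measure.map_finset_sum hφ.aemeasurable]
  simp [Measure.map_dirac' hφ]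

lemma integrable_empiricalMeasure [Nonempty X] [MeasurableSingletonClass X] {E : Type*}
    [NormedAddCommGroup E] (hs : s.Nonempty) (f : X → E) :
    Integrable f (empiricalMeasure s g : Measure X) := by
  rw [toMeasure_empiricalMeasure hs]
  refine Integrable.smul_measure ?_ (by simpa using hs.ne_empty)
  exact integrable_finsetSum_measure.mpr fun i _ ↦ integrable_dirac (by simp)

lemma integral_empiricalMeasure [Nonempty X] [MeasurableSingletonClass X] {E : Type*}
    [NormedAddCommGroup E] [NormedSpace ℝ E] [CompleteSpace E] (hs : s.Nonempty) (f : X → E) :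
    ∫ x, f x ∂(empiricalMeasure s g : Measure X) = (#s : ℝ)⁻¹ • ∑ i ∈ s, f (g i) := by
  rw [toMeasure_empiricalMeasure hs, integral_smul_measure,
    integral_finsetSum_measure fun i _ ↦ integrable_dirac (by simp)]
  simp

end Empirical

section Radial

open scoped Finset

/-- The law `2 s ds` on `(0, 1]` of the radius of a uniformly distributed point of the unit disc;
it is the limit law of `c / N` for Farey fractions of order `N` with denominator `c`. -/
noncomputable def radialMeasure : Measure ℝ :=
  (volume.restrict (Set.Ioc 0 1)).withDensity fun s ↦ ENNReal.ofReal (2 * s)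

lemma radialMeasure_of_inter_eq_Ioc {E : Set ℝ} (hE : MeasurableSet E) {t : ℝ} (ht : 0 ≤ t)
    (h : E ∩ Set.Ioc 0 1 = Set.Ioc 0 t) : radialMeasure E = ENNReal.ofReal (t ^ 2) := by
  rw [radialMeasure, withDensity_apply _ hE, Measure.restrict_restrict hE, h,
    ← ofReal_integral_eq_lintegral_ofReal]
  · rw [← intervalIntegral.integral_of_le ht, intervalIntegral.integral_const_mul, integral_id]
    ring_nf
  · exact Continuous.integrableOn_Ioc (by fun_prop)
  · filter_upwards [ae_restrict_mem measurableSet_Ioc] with s hs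
    exact mul_nonneg zero_le_two hs.1.le

instance : IsProbabilityMeasure radialMeasure :=
  ⟨by simpa using radialMeasure_of_inter_eq_Ioc .univ zero_le_one (Set.univ_inter _)⟩

lemma radialMeasure_real_Iic (t : ℝ) :
    radialMeasure.real (Set.Iic t) = (max 0 (min t 1)) ^ 2 := by
  rw [measureReal_def, radialMeasure_of_inter_eq_Ioc measurableSet_Iic (le_max_left 0 (min t 1)),
    ENNReal.toReal_ofReal (sq_nonneg _)]
  ext s
  simp only [Set.mem_inter_iff, Set.mem_Iic, Set.mem_Ioc]
  grind

lemma measureReal_Ioc_prod {X : Type*} [MeasurableSpace X] (ν : Measure (ℝ × X))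
    [IsFiniteMeasure ν] {a b : ℝ} (hab : a ≤ b) {E : Set X} (hE : MeasurableSet E) :
    ν.real (Set.Ioc a b ×ˢ E) = ν.real (Set.Iic b ×ˢ E) - ν.real (Set.Iic a ×ˢ E) := by
  rw [← measureReal_sdiff (Set.prod_mono_left (Set.Iic_subset_Iic.mpr hab))
    (measurableSet_Iic.prod hE)]
  congr 1
  ext x
  simp only [Set.mem_prod, Set.mem_Ioc, Set.mem_sdiff, Set.mem_Iic]
  grind

variable {X ι : Type*} [MeasurableSpace X]

lemma tendsto_prod_of_tendsto_Iic_prod [TopologicalSpace X] [SecondCountableTopology X]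
    [TopologicalSpace.PseudoMetrizableSpace X] [OpensMeasurableSpace X]
    {l : Filter ι} [l.IsCountablyGenerated]
    {μs : ι → ProbabilityMeasure (ℝ × X)} {ν : ProbabilityMeasure ℝ} {μ : ProbabilityMeasure X}
    (h : ∀ (t : ℝ) (E : Set X), MeasurableSet E → (μ : Measure X) (frontier E) = 0 →
      Tendsto (fun i ↦ (μs i : Measure (ℝ × X)).real (Set.Iic t ×ˢ E)) l
        (𝓝 ((ν : Measure ℝ).real (Set.Iic t) * (μ : Measure X).real E))) :
    Tendsto μs l (𝓝 (ν.prod μ)) := by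
  let S : Set (Set (ℝ × X)) := {s | ∃ (a b : ℝ) (E : Set X),
    MeasurableSet E ∧ (μ : Measure X) (frontier E) = 0 ∧ s = Set.Ioc a b ×ˢ E}
  have hS : IsPiSystem S := by
    rintro - ⟨a, b, E, hE, hμE, rfl⟩ - ⟨a', b', E', hE', hμE', rfl⟩ -
    refine ⟨max a a', min b b', E ∩ E', hE.inter hE', null_frontier_inter hμE hμE', ?_⟩
    rw [Set.prod_inter_prod, Set.Ioc_inter_Ioc]
  refine hS.tendsto_probabilityMeasure_of_tendsto_of_mem ?_ ?_ ?_
  · rintro - ⟨a, b, E, hE, -, rfl⟩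
    exact measurableSet_Ioc.prod hE
  · let : PseudoMetricSpace X := TopologicalSpace.pseudoMetrizableSpacePseudoMetric X
    intro u hu x hxu
    obtain ⟨ε, hε, hεu⟩ := Metric.isOpen_iff.mp hu x hxu
    obtain ⟨r, hr, hμr⟩ := exists_null_frontier_thickening (μ : Measure X) {x.2} hε
    rw [Metric.thickening_singleton] at hμr
    refine ⟨_, ⟨x.1 - ε / 2, x.1 + ε / 2, _, Metric.isOpen_ball.measurableSet, hμr, rfl⟩,
      prod_mem_nhds (Ioc_mem_nhds (by linarith) (by linarith)) (Metric.ball_mem_nhds _ hr.1), ?_⟩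
    refine subset_trans ?_ hεu
    rw [← ball_prod_same, Real.ball_eq_Ioo]
    exact Set.prod_mono (Set.Ioc_subset_Ioo (by linarith) (by linarith))
      (Metric.ball_subset_ball hr.2.le)
  · rintro - ⟨a, b, E, hE, hμE, rfl⟩
    rcases lt_or_ge b a with hba | hab
    · simpa [Set.Ioc_eq_empty_of_le hba.le] using tendsto_const_nhds
    · rw [← NNReal.tendsto_coe]
      change Tendsto (fun i ↦ (μs i : Measure (ℝ × X)).real (Set.Ioc a b ×ˢ E)) l
        (𝓝 ((ν.prod μ : Measure (ℝ × X)).real (Set.Ioc a b ×ˢ E)))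
      simp only [measureReal_Ioc_prod _ hab hE, ProbabilityMeasure.toMeasure_prod,
        measureReal_prod_prod]
      exact (h b E hE hμE).sub (h a E hE hμE)

variable [Nonempty X] {F : ℕ → Finset ι} {w : ι → ℕ} {g : ι → X}

lemma empiricalMeasure_real_Iic_prod (hF : ∀ m N, m ≤ N → F m = {i ∈ F N | w i ≤ m}) {t : ℝ}
    (ht : 0 ≤ t) (ht1 : t ≤ 1) {N : ℕ} (hN : 0 < N) (hFt : (F ⌊t * N⌋₊).Nonempty) {E : Set X}
    (hE : MeasurableSet E) :
    (empiricalMeasure (F N) fun i ↦ ((w i / N : ℝ), g i) : Measure (ℝ × X)).real (Set.Iic t ×ˢ E) =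
      #(F ⌊t * N⌋₊) / #(F N) * (empiricalMeasure (F ⌊t * N⌋₊) g : Measure X).real E := by
  classical
  have hFt' : F ⌊t * N⌋₊ = {i ∈ F N | w i ≤ ⌊t * N⌋₊} :=
    hF _ _ (Nat.floor_le_of_le (mul_le_of_le_one_left N.cast_nonneg ht1))
  have hFN : (F N).Nonempty := (hFt' ▸ hFt).mono (Finset.filter_subset _ _)
  rw [empiricalMeasure_apply hFN (measurableSet_Iic.prod hE), empiricalMeasure_apply hFt hE,
    div_mul_div_comm, mul_comm, mul_div_mul_right _ _ (by exact_mod_cast hFt.card_pos.ne')]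
  congr 3
  rw [hFt', Finset.filter_filter]
  refine Finset.filter_congr fun i _ ↦ ?_
  rw [Nat.le_floor_iff (by positivity), ← div_le_iff₀ (by exact_mod_cast hN)]
  rfl

variable (hF : ∀ m N, m ≤ N → F m = {i ∈ F N | w i ≤ m})
  (hratio : ∀ t : ℝ, 0 < t → t ≤ 1 →
    Tendsto (fun N : ℕ ↦ (#(F ⌊t * N⌋₊) / #(F N) : ℝ)) atTop (𝓝 (t ^ 2)))

include hratio in
lemma eventually_nonempty_of_tendsto_ratio {t : ℝ} (ht : 0 < t) (ht1 : t ≤ 1) :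
    ∀ᶠ N : ℕ in atTop, (F ⌊t * N⌋₊).Nonempty := by
  filter_upwards [(hratio t ht ht1).eventually_ne (pow_ne_zero 2 ht.ne')] with N hN
  refine Finset.nonempty_iff_ne_empty.mpr fun h ↦ hN ?_
  simp [h]

include hF hratio in
lemma tendsto_empiricalMeasure_real_Iic_prod_of_le_one {E : Set X} (hE : MeasurableSet E) {c : ℝ}
    (h : Tendsto (fun N ↦ (empiricalMeasure (F N) g : Measure X).real E) atTop (𝓝 c)) {t : ℝ}
    (ht : 0 < t) (ht1 : t ≤ 1) :
    Tendsto (fun N : ℕ ↦ (empiricalMeasure (F N) fun i ↦ ((w i / N : ℝ), g i) :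
      Measure (ℝ × X)).real (Set.Iic t ×ˢ E)) atTop (𝓝 (t ^ 2 * c)) := by
  have hfloor : Tendsto (fun N : ℕ ↦ ⌊t * N⌋₊) atTop atTop :=
    tendsto_nat_floor_atTop.comp (tendsto_natCast_atTop_atTop.const_mul_atTop ht)
  refine ((hratio t ht ht1).mul (h.comp hfloor)).congr' ?_
  filter_upwards [eventually_gt_atTop 0, eventually_nonempty_of_tendsto_ratio hratio ht ht1]
    with N hN hFt
  exact (empiricalMeasure_real_Iic_prod hF ht.le ht1 hN hFt hE).symm

include hF hratio in
lemma tendsto_empiricalMeasure_real_Iic_prod (hpos : ∀ N, ∀ i ∈ F N, 0 < w i)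
    {E : Set X} (hE : MeasurableSet E) {c : ℝ}
    (h : Tendsto (fun N ↦ (empiricalMeasure (F N) g : Measure X).real E) atTop (𝓝 c)) (t : ℝ) :
    Tendsto (fun N : ℕ ↦ (empiricalMeasure (F N) fun i ↦ ((w i / N : ℝ), g i) :
      Measure (ℝ × X)).real (Set.Iic t ×ˢ E)) atTop (𝓝 ((max 0 (min t 1)) ^ 2 * c)) := by
  classical
  have hmem {N : ℕ} (hN : 0 < N) {i : ι} (hi : i ∈ F N) : (w i / N : ℝ) ∈ Set.Ioc (0 : ℝ) 1 := by
    have hN' : (0 : ℝ) < N := by exact_mod_cast hN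
    have hwN : w i ≤ N :=
      (Finset.mem_filter.mp (by rwa [← hF N N le_rfl] : i ∈ {i ∈ F N | w i ≤ N})).2
    exact ⟨div_pos (by exact_mod_cast hpos N i hi) hN',
      (div_le_one hN').mpr (by exact_mod_cast hwN)⟩
  have hne := eventually_nonempty_of_tendsto_ratio hratio one_pos le_rfl
  simp only [one_mul, Nat.floor_natCast] at hne
  have hle_one {t : ℝ} := tendsto_empiricalMeasure_real_Iic_prod_of_le_one (t := t) hF hratio hE h
  rcases le_or_gt t 0 with ht | ht
  · rw [max_eq_left (min_le_of_left_le ht), zero_pow two_ne_zero, zero_mul]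
    refine tendsto_const_nhds.congr' ?_
    filter_upwards [eventually_gt_atTop 0, hne] with N hN hFN
    rw [empiricalMeasure_apply hFN (measurableSet_Iic.prod hE), Finset.filter_false_of_mem]
    · simp
    · exact fun i hi hi' ↦ ((hmem hN hi).1.trans_le hi'.1).not_ge ht
  rcases le_total t 1 with ht1 | ht1
  · simpa only [min_eq_left ht1, max_eq_right ht.le] using hle_one ht ht1
  · rw [min_eq_right ht1, max_eq_right zero_le_one]
    refine (hle_one one_pos le_rfl).congr' ?_
    filter_upwards [eventually_gt_atTop 0, hne] with N hN hFN
    rw [empiricalMeasure_apply hFN (measurableSet_Iic.prod hE),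
      empiricalMeasure_apply hFN (measurableSet_Iic.prod hE)]
    congr 3
    refine Finset.filter_congr fun i hi ↦ ?_
    simp only [Set.mem_prod, Set.mem_Iic, (hmem hN hi).2, (hmem hN hi).2.trans ht1]

include hF hratio in
lemma tendsto_empiricalMeasure_prodMk [TopologicalSpace X] [SecondCountableTopology X]
    [TopologicalSpace.PseudoMetrizableSpace X] [OpensMeasurableSpace X]
    (hpos : ∀ N, ∀ i ∈ F N, 0 < w i) {μ : ProbabilityMeasure X}
    (h : Tendsto (fun N ↦ empiricalMeasure (F N) g) atTop (𝓝 μ)) :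
    Tendsto (fun N : ℕ ↦ empiricalMeasure (F N) fun i ↦ ((w i / N : ℝ), g i)) atTop
      (𝓝 (ProbabilityMeasure.prod ⟨radialMeasure, inferInstance⟩ μ)) := by
  refine tendsto_prod_of_tendsto_Iic_prod fun t E hE hμE ↦ ?_
  rw [ProbabilityMeasure.coe_mk, radialMeasure_real_Iic]
  refine tendsto_empiricalMeasure_real_Iic_prod hF hratio hpos hE ?_ t
  exact (ENNReal.tendsto_toReal (measure_ne_top _ _)).comp
    (ProbabilityMeasure.tendsto_measure_of_null_frontier_of_tendsto' h hμE)

end Radial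

section FareyFractions

open Finset

/-- The Farey fractions of order `N` in `(0, 1]`. -/
def fareyFractions (N : ℕ) : Finset ℚ :=
  (Icc 1 N).biUnion fun c ↦ {x ∈ Icc 1 c | x.Coprime c}.image fun x : ℕ ↦ (x / c : ℚ)

lemma num_natCast_div {x c : ℕ} (hc : 0 < c) (h : x.Coprime c) : (x / c : ℚ).num = x := by
  simpa using Rat.num_div_eq_of_coprime (a := x) (b := c) (by exact_mod_cast hc) h

lemma den_natCast_div {x c : ℕ} (hc : 0 < c) (h : x.Coprime c) : (x / c : ℚ).den = c := by
  simpa using Rat.den_div_eq_of_coprime (a := x) (b := c) (by exact_mod_cast hc) h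

lemma sum_fareyFractions {M : Type*} [AddCommMonoid M] (N : ℕ) (G : ℚ → M) :
    ∑ r ∈ fareyFractions N, G r = ∑ c ∈ Icc 1 N, ∑ x ∈ Icc 1 c with x.Coprime c, G (x / c) := by
  rw [fareyFractions, sum_biUnion]
  · refine sum_congr rfl fun c hc ↦ sum_image fun _ _ _ _ hxy ↦ ?_
    have hc : (c : ℚ) ≠ 0 := Nat.cast_ne_zero.mpr (Nat.one_le_iff_ne_zero.mp (mem_Icc.mp hc).1)
    exact_mod_cast (div_left_inj' hc).mp hxy
  · intro c hc d hd hcd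
    refine disjoint_left.mpr fun r hr hr' ↦ hcd ?_
    simp only [mem_image, mem_filter] at hr hr'
    obtain ⟨x, ⟨-, hx⟩, rfl⟩ := hr
    obtain ⟨y, ⟨-, hy⟩, hxy⟩ := hr'
    rw [← den_natCast_div (mem_Icc.mp hc).1 hx, ← hxy, den_natCast_div (mem_Icc.mp hd).1 hy]

lemma mem_fareyFractions {N : ℕ} {r : ℚ} : r ∈ fareyFractions N ↔ 0 < r ∧ r ≤ 1 ∧ r.den ≤ N := by
  simp only [fareyFractions, mem_biUnion, mem_image, mem_filter, mem_Icc]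
  constructor
  · rintro ⟨c, ⟨hc, hcN⟩, x, ⟨⟨hx, hxc⟩, hcop⟩, rfl⟩
    have hc' : (0 : ℚ) < c := by exact_mod_cast hc
    exact ⟨div_pos (by exact_mod_cast hx) hc', (div_le_one hc').mpr (by exact_mod_cast hxc),
      by rwa [den_natCast_div hc hcop]⟩
  · rintro ⟨hr, hr1, hrN⟩
    have hnum : (r.num.natAbs : ℤ) = r.num := Int.natAbs_of_nonneg (Rat.num_nonneg.mpr hr.le)
    have hle : r.num ≤ r.den := by rwa [← Rat.num_div_den r, div_le_one₀ (by exact_mod_cast r.pos),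
      ← Int.cast_natCast, Int.cast_le] at hr1
    have hpos : 0 < r.num := Rat.num_pos.mpr hr
    refine ⟨r.den, ⟨r.pos, hrN⟩, r.num.natAbs, ⟨⟨by omega, by omega⟩, r.reduced⟩, ?_⟩
    rw [← Int.cast_natCast, hnum, Rat.num_div_den]

lemma card_fareyFractions (N : ℕ) : #(fareyFractions N) = ∑ c ∈ Icc 1 N, c.totient := by
  rw [card_eq_sum_ones, sum_fareyFractions]
  refine sum_congr rfl fun c hc ↦ ?_
  have : NeZero c := ⟨by have := mem_Icc.mp hc; omega⟩
  rw [← sum_units_zmod_eq_sum_Icc fun _ ↦ 1, ← card_eq_sum_ones, card_univ,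
    ZMod.card_units_eq_totient]

lemma fareyFractions_nonempty {N : ℕ} (hN : 0 < N) : (fareyFractions N).Nonempty :=
  ⟨1, mem_fareyFractions.mpr ⟨one_pos, le_rfl, hN⟩⟩

lemma fareyFractions_eq_filter {m N : ℕ} (h : m ≤ N) :
    fareyFractions m = {r ∈ fareyFractions N | r.den ≤ m} := by
  ext r
  simp only [mem_filter, mem_fareyFractions]
  grind

lemma fareyIndex_eq_card {N : ℕ} (hN : 0 < N) : fareyIndex N = #(fareyFractions N) := by
  have hset : fareySet N = insert 0 (fareyFractions N : Set ℚ) := by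
    ext r
    simp only [fareySet, Set.mem_insert_iff, mem_coe, mem_fareyFractions]
    constructor
    · rintro ⟨h0, h1, hrN⟩
      exact h0.eq_or_lt.imp Eq.symm fun h ↦ ⟨h, h1, hrN⟩
    · rintro (rfl | ⟨h0, h1, hrN⟩)
      · exact ⟨le_rfl, zero_le_one, hN⟩
      · exact ⟨h0.le, h1, hrN⟩
  rw [fareyIndex, hset, Set.ncard_insert_of_notMem (by simp [mem_fareyFractions])
    (finite_toSet _), Set.ncard_coe_finset, Nat.add_sub_cancel]

lemma tendsto_card_fareyFractions_div_sq :
    Tendsto (fun N : ℕ ↦ (#(fareyFractions N) / (N : ℝ) ^ 2)) atTop (𝓝 (3 / Real.pi ^ 2)) := by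
  simpa only [card_fareyFractions, Nat.cast_sum] using tendsto_sum_totient_div_sq

lemma tendsto_card_fareyFractions_floor_div {t : ℝ} (ht : 0 < t) :
    Tendsto (fun N : ℕ ↦ (#(fareyFractions ⌊t * N⌋₊) / #(fareyFractions N) : ℝ)) atTop
      (𝓝 (t ^ 2)) := by
  have hfloor : Tendsto (fun N : ℕ ↦ ⌊t * N⌋₊) atTop atTop :=
    tendsto_nat_floor_atTop.comp (tendsto_natCast_atTop_atTop.const_mul_atTop ht)
  have hsq := ((tendsto_nat_floor_mul_div_atTop ht.le).comp
    (tendsto_natCast_atTop_atTop (R := ℝ))).pow 2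
  have hdensity : 3 / Real.pi ^ 2 ≠ 0 := by positivity
  have hlim := ((tendsto_card_fareyFractions_div_sq.comp hfloor).mul hsq).div
    tendsto_card_fareyFractions_div_sq hdensity
  rw [mul_div_cancel_left₀ _ hdensity] at hlim
  refine hlim.congr' ?_
  filter_upwards [eventually_gt_atTop 0, hfloor.eventually_gt_atTop 0] with N hN hN'
  have : (0 : ℝ) < #(fareyFractions N) := by exact_mod_cast (fareyFractions_nonempty hN).card_pos
  simp only [Function.comp_apply, Pi.div_apply]
  field_simp

end FareyFractions

section FareyPhase

open Finset

/-- The point `-x⁻¹ / c` of the circle attached to the reduced fraction `x / c`, where `x⁻¹` is the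
inverse of `x` modulo `c`. It determines the denominator of the next Farey fraction of any order:
that denominator is congruent to `-x⁻¹` modulo `c`. -/
noncomputable def fareyPhase (r : ℚ) : UnitAddCircle :=
  ((-(r.num : ZMod r.den)⁻¹).val / r.den : ℝ)

lemma fareyPhase_eq_toAddCircle {r : ℚ} {c : ℕ} [NeZero c] (h : r.den = c) :
    fareyPhase r = ZMod.toAddCircle (-(r.num : ZMod c)⁻¹) := by
  subst h
  rw [ZMod.toAddCircle_apply, fareyPhase]

/-- The point of the torus attached to a Farey fraction whose Fourier coefficients sum to
Kloosterman sums. -/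
noncomputable def fareyTorusPoint (r : ℚ) : UnitAddTorus (Fin 2) :=
  ![fareyPhase r, ((r : ℝ) : UnitAddCircle)]

lemma fourier_toAddCircle {c : ℕ} [NeZero c] (k : ℤ) (j : ZMod c) :
    fourier (T := 1) k (ZMod.toAddCircle j) = ZMod.stdAddChar ((k : ZMod c) * j) := by
  rw [fourier_apply, ZMod.stdAddChar_apply, ← map_zsmul, ← zsmul_eq_mul]
  rfl

lemma mFourier_fareyTorusPoint {c x : ℕ} [NeZero c] (h : x.Coprime c) (n : Fin 2 → ℤ) :
    UnitAddTorus.mFourier n (fareyTorusPoint (x / c)) =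
      ZMod.stdAddChar (N := c) (n 1 * x + (-n 0 : ℤ) * (x : ZMod c)⁻¹) := by
  have hc : 0 < c := NeZero.pos c
  have hx : (((x / c : ℚ) : ℝ) : UnitAddCircle) = ZMod.toAddCircle (x : ZMod c) := by
    rw [ZMod.toAddCircle_natCast]
    push_cast
    rfl
  rw [UnitAddTorus.mFourier, ContinuousMap.coe_mk, Fin.prod_univ_two, fareyTorusPoint]
  simp only [Matrix.cons_val_zero, Matrix.cons_val_one, hx,
    fareyPhase_eq_toAddCircle (den_natCast_div hc h), num_natCast_div hc h,
    fourier_toAddCircle, ← AddChar.map_add_eq_mul]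
  congr 1
  push_cast
  ring

lemma norm_sum_mFourier_fareyTorusPoint_le {n : Fin 2 → ℤ} (hn : n ≠ 0) (N : ℕ) :
    ‖∑ r ∈ fareyFractions N, UnitAddTorus.mFourier n (fareyTorusPoint r)‖ ≤
      2 * ((n 1).natAbs + (n 0).natAbs : ℕ) *
        ∑ c ∈ Icc 1 N, (N : ℝ) ^ (3 / 4 : ℝ) * #c.divisors := by
  have hn' : n 1 ≠ 0 ∨ -n 0 ≠ 0 := by
    by_contra! h
    exact hn (funext fun i ↦ by fin_cases i <;> simp [h.1, neg_eq_zero.mp h.2])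
  rw [sum_fareyFractions, mul_sum]
  refine norm_sum_le_of_le _ fun c hc ↦ ?_
  have : NeZero c := ⟨by have := mem_Icc.mp hc; omega⟩
  have hsum : ∑ x ∈ Icc 1 c with x.Coprime c,
      UnitAddTorus.mFourier n (fareyTorusPoint (x / c)) = kloosterman c (n 1) (-n 0 : ℤ) := by
    rw [kloosterman]
    simp only [← ZMod.inv_coe_unit]
    rw [sum_units_zmod_eq_sum_Icc fun a : ZMod c ↦
      ZMod.stdAddChar (N := c) (n 1 * a + (-n 0 : ℤ) * a⁻¹)]
    exact sum_congr rfl fun x hx ↦ mFourier_fareyTorusPoint (mem_filter.mp hx).2 n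
  rw [hsum, ← Int.natAbs_neg (n 0)]
  exact norm_kloosterman_le (mem_Icc.mp hc).2 hn'

lemma tendsto_empiricalMeasure_fareyTorusPoint :
    Tendsto (fun N ↦ empiricalMeasure (fareyFractions N) fareyTorusPoint) atTop
      (𝓝 ⟨volume, inferInstance⟩) := by
  refine tendsto_volume_of_tendsto_integral_mFourier fun n hn ↦ ?_
  have hlim := (tendsto_sum_rpow_mul_card_divisors.div tendsto_card_fareyFractions_div_sq
    (by positivity)).const_mul (2 * ((n 1).natAbs + (n 0).natAbs : ℕ) : ℝ)
  rw [zero_div, mul_zero] at hlim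
  refine squeeze_zero_norm' ?_ hlim
  filter_upwards [eventually_gt_atTop 0] with N hN
  rw [integral_empiricalMeasure (fareyFractions_nonempty hN), norm_smul, Pi.div_apply,
    div_div_div_cancel_right₀ (by positivity), ← mul_div_assoc, norm_inv, RCLike.norm_natCast,
    inv_mul_eq_div]
  gcongr
  exact norm_sum_mFourier_fareyTorusPoint_le hn N

end FareyPhase

section Suspension

/-- The representative in `(0, 1]` of a point of the circle `ℝ / ℤ`. -/
noncomputable def iocRepr (θ : UnitAddCircle) : ℝ := (AddCircle.equivIoc (1 : ℝ) 0 θ).1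

lemma iocRepr_mem (θ : UnitAddCircle) : iocRepr θ ∈ Set.Ioc 0 1 := by
  simpa only [iocRepr, zero_add] using (AddCircle.equivIoc (1 : ℝ) 0 θ).2

lemma iocRepr_coe {u : ℝ} (hu : u ∈ Set.Ioc 0 1) : iocRepr u = u :=
  AddCircle.equivIoc_coe_of_mem (by rwa [zero_add])

lemma coe_iocRepr (θ : UnitAddCircle) : (iocRepr θ : UnitAddCircle) = θ :=
  AddCircle.coe_equivIoc

lemma continuousAt_iocRepr {θ : UnitAddCircle} (hθ : θ ≠ 0) : ContinuousAt iocRepr θ :=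
  continuousAt_subtype_val.comp (AddCircle.continuousAt_equivIoc 1 0 hθ)

lemma measurePreserving_iocRepr :
    MeasurePreserving iocRepr volume (volume.restrict (Set.Ioc 0 1)) := by
  simpa only [zero_add] using! (measurePreserving_subtype_coe measurableSet_Ioc).comp
    (AddCircle.measurePreserving_equivIoc (1 : ℝ) (a := 0))

/-- The parametrization `(s, θ) ↦ (s, y)` of the Farey triangle, where `y` is the element of
`(1 - s, 1]` congruent to `s θ` modulo `s`. -/
noncomputable def suspensionMap (x : ℝ × UnitAddCircle) : ℝ × ℝ :=
  (x.1, 1 - x.1 + x.1 * iocRepr (x.2 - (x.1⁻¹ : ℝ)))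

lemma suspensionMap_coe_div {s y : ℝ} (hs : 0 < s) (hy : y ∈ Set.Ioc (1 - s) 1) :
    suspensionMap (s, (y / s : ℝ)) = (s, y) := by
  have hmem : (y + s - 1) / s ∈ Set.Ioc 0 1 :=
    ⟨div_pos (by linarith [hy.1]) hs, (div_le_one hs).mpr (by linarith [hy.2])⟩
  have hcoe : ((y / s : ℝ) : UnitAddCircle) - (s⁻¹ : ℝ) = ((y + s - 1) / s : ℝ) := by
    rw [← AddCircle.coe_sub, ← AddCircle.coe_add_period 1 (y / s - s⁻¹)]
    congr 1
    field_simp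
    ring
  rw [suspensionMap, hcoe, iocRepr_coe hmem]
  ext
  · rfl
  · field_simp
    ring

lemma suspensionMap_mem_fareyTriangle {s : ℝ} (hs : s ∈ Set.Ioc 0 1) (θ : UnitAddCircle) :
    suspensionMap (s, θ) ∈ fareyTriangle := by
  obtain ⟨hu0, hu1⟩ := iocRepr_mem (θ - (s⁻¹ : ℝ))
  have h0 := mul_pos hs.1 hu0
  have h1 := mul_le_of_le_one_right hs.1.le hu1
  refine ⟨hs.1, hs.2, ?_, ?_, ?_⟩ <;> simp only [suspensionMap] <;> linarith [hs.2]

lemma measurable_suspensionMap : Measurable suspensionMap := by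
  have hcoe : Measurable fun s : ℝ ↦ (s : UnitAddCircle) := AddCircle.measurable_mk'
  exact measurable_fst.prodMk ((measurable_const.sub measurable_fst).add (measurable_fst.mul
    (measurePreserving_iocRepr.measurable.comp
      (measurable_snd.sub (hcoe.comp measurable_fst.inv)))))

lemma ofReal_mul_volume_restrict_Ioc_preimage_affine {s : ℝ} (hs : 0 < s) (t : ℝ) {E : Set ℝ}
    (hE : MeasurableSet E) :
    ENNReal.ofReal s * volume.restrict (Set.Ioc 0 1) ((fun u ↦ t + s * u) ⁻¹' E) =
      volume (E ∩ Set.Ioc t (t + s)) := by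
  have hpre : Measurable fun u ↦ t + s * u := by fun_prop
  have haffine : (fun u ↦ t + s * u) ⁻¹' E ∩ Set.Ioc 0 1 =
      (s * ·) ⁻¹' ((t + ·) ⁻¹' (E ∩ Set.Ioc t (t + s))) := by
    ext u
    simp only [Set.mem_inter_iff, Set.mem_preimage, Set.mem_Ioc, lt_add_iff_pos_right,
      mul_pos_iff_of_pos_left hs, add_le_add_iff_left, mul_le_iff_le_one_right hs]
  rw [Measure.restrict_apply (hpre hE), haffine, Real.volume_preimage_mul_left hs.ne',
    measure_preimage_add, ← mul_assoc, ← ENNReal.ofReal_mul hs.le, abs_of_pos (inv_pos.mpr hs),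
    mul_inv_cancel₀ hs.ne', ENNReal.ofReal_one, one_mul]

lemma ofReal_mul_volume_preimage_suspensionMap {s : ℝ} (hs : 0 < s) {E : Set ℝ}
    (hE : MeasurableSet E) :
    ENNReal.ofReal s * volume {θ | (suspensionMap (s, θ)).2 ∈ E} =
      volume (E ∩ Set.Ioc (1 - s) 1) := by
  have hrepr := measurePreserving_iocRepr.comp
    (measurePreserving_sub_right volume ((s⁻¹ : ℝ) : UnitAddCircle))
  have hpre : MeasurableSet ((fun u ↦ 1 - s + s * u) ⁻¹' E) :=
    (by fun_prop : Measurable fun u ↦ 1 - s + s * u) hE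
  have h := ofReal_mul_volume_restrict_Ioc_preimage_affine hs (1 - s) hE
  rwa [sub_add_cancel, ← hrepr.measure_preimage hpre.nullMeasurableSet] at h

lemma measurableSet_fareyTriangle : MeasurableSet fareyTriangle := by
  unfold fareyTriangle
  measurability

lemma preimage_mk_fareyTriangle (s : ℝ) :
    Prod.mk s ⁻¹' fareyTriangle = if s ∈ Set.Ioc 0 1 then Set.Ioc (1 - s) 1 else ∅ := by
  ext y
  split_ifs with hs <;> simp only [fareyTriangle, Set.mem_preimage, Set.mem_ofPred_eq, Set.mem_Ioc,
    Set.mem_empty_iff_false, iff_false] at hs ⊢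
  · constructor
    · rintro ⟨-, -, -, hy, hsy⟩
      exact ⟨by linarith, hy⟩
    · rintro ⟨hsy, hy⟩
      exact ⟨hs.1, hs.2, by linarith, hy, by linarith⟩
  · exact fun h ↦ hs ⟨h.1, h.2.1⟩

lemma measurePreserving_suspensionMap :
    MeasurePreserving suspensionMap (radialMeasure.prod volume) fareyMeasure := by
  refine ⟨measurable_suspensionMap, ?_⟩
  ext E hE
  have hE' := hE.inter measurableSet_fareyTriangle
  rw [Measure.map_apply measurable_suspensionMap hE,
    Measure.prod_apply (measurable_suspensionMap hE), radialMeasure,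
    lintegral_withDensity_eq_lintegral_mul _ (by fun_prop)
      (measurable_measure_prodMk_left (measurable_suspensionMap hE)), fareyMeasure,
    Measure.smul_apply, Measure.restrict_apply hE, Measure.volume_eq_prod,
    Measure.prod_apply hE', smul_eq_mul, ← lintegral_const_mul _
      (measurable_measure_prodMk_left hE'), ← lintegral_indicator measurableSet_Ioc]
  refine lintegral_congr fun s ↦ ?_
  rw [Set.preimage_inter, preimage_mk_fareyTriangle]
  split_ifs with hs
  · rw [Set.indicator_of_mem hs, ← ofReal_mul_volume_preimage_suspensionMap hs.1
      (measurable_prodMk_left hE), Pi.mul_apply, ENNReal.ofReal_mul zero_le_two,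
      ENNReal.ofReal_ofNat, mul_assoc]
    rfl
  · rw [Set.indicator_of_notMem hs, Set.inter_empty, measure_empty, mul_zero]

instance : IsProbabilityMeasure fareyMeasure := by
  rw [← measurePreserving_suspensionMap.map_eq]
  exact Measure.isProbabilityMeasure_map measurable_suspensionMap.aemeasurable

instance : NullSingletonClass (volume : Measure UnitAddCircle) :=
  ⟨fun θ ↦ by simpa using AddCircle.volume_closedBall 1 (x := θ) 0⟩

lemma continuousAt_sub_coe_inv {x : ℝ × UnitAddCircle} (hx : x.1 ≠ 0) :
    ContinuousAt (fun x : ℝ × UnitAddCircle ↦ x.2 - (x.1⁻¹ : ℝ)) x :=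
  continuousAt_snd.sub ((AddCircle.continuous_mk' 1).continuousAt.comp (continuousAt_fst.inv₀ hx))

lemma continuousAt_suspensionMap {x : ℝ × UnitAddCircle} (hx : x.1 ≠ 0)
    (hx' : x.2 - (x.1⁻¹ : ℝ) ≠ 0) : ContinuousAt suspensionMap x := by
  have hrepr : ContinuousAt (fun x : ℝ × UnitAddCircle ↦ iocRepr (x.2 - (x.1⁻¹ : ℝ))) x :=
    (continuousAt_iocRepr hx').comp_of_eq (continuousAt_sub_coe_inv hx) rfl
  unfold suspensionMap
  fun_prop

lemma exists_isOpen_continuousOn_suspensionMap :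
    ∃ U : Set (ℝ × UnitAddCircle), IsOpen U ∧ ContinuousOn suspensionMap U ∧
      radialMeasure.prod volume Uᶜ = 0 := by
  have hopen : IsOpen ({x : ℝ × UnitAddCircle | x.1 ≠ 0} ∩ (fun x ↦ x.2 - (x.1⁻¹ : ℝ)) ⁻¹' {0}ᶜ) :=
    (continuousOn_of_forall_continuousAt
      fun x hx ↦ continuousAt_sub_coe_inv hx).isOpen_inter_preimage
        (isOpen_ne_fun continuous_fst continuous_const) isOpen_compl_singleton
  refine ⟨_, hopen, continuousOn_of_forall_continuousAt fun x hx ↦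
    continuousAt_suspensionMap hx.1 hx.2, ?_⟩
  rw [Measure.measure_prod_null hopen.measurableSet.compl]
  refine (withDensity_absolutelyContinuous _ _).ae_le ?_
  filter_upwards [ae_restrict_mem measurableSet_Ioc] with s hs
  refine measure_mono_null (t := {((s⁻¹ : ℝ) : UnitAddCircle)}) (fun θ hθ ↦ ?_)
    (measure_singleton _)
  by_contra hne
  exact hθ ⟨hs.1.ne', sub_ne_zero.mpr hne⟩

end Suspension

section FareyPoints

/-- The point `(c / n, c' / n)` of the Farey triangle, where `c` is the denominator of the Farey
fraction `r` of order `n` and `c'` that of its successor, see `fareyPoint_eq`. -/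
noncomputable def fareyPoint (n : ℕ) (r : ℚ) : ℝ × ℝ :=
  suspensionMap (r.den / n, fareyPhase r)

lemma fareyPoint_eq {n : ℕ} (hn : 0 < n) {r : ℚ} {y : ℤ} (hmod : (r.den : ℤ) ∣ y * r.num + 1)
    (hy : y ∈ Set.Ioc (n - r.den : ℤ) n) : fareyPoint n r = ((r.den / n, y / n) : ℝ × ℝ) := by
  have : NeZero r.den := ⟨r.den_nz⟩
  have hn' : (0 : ℝ) < n := by exact_mod_cast hn
  have hden : (0 : ℝ) < r.den := by exact_mod_cast r.pos
  have hphase : fareyPhase r = ((y / n / (r.den / n) : ℝ) : UnitAddCircle) := by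
    have hinv : -(r.num : ZMod r.den)⁻¹ = y := by
      have hmul : (r.num : ZMod r.den) * -y = 1 := by
        have := (ZMod.intCast_zmod_eq_zero_iff_dvd _ _).mpr hmod
        push_cast at this
        linear_combination -this
      rw [ZMod.inv_eq_of_mul_eq_one _ _ _ hmul, neg_neg]
    rw [fareyPhase_eq_toAddCircle rfl, hinv, ZMod.toAddCircle_intCast,
      div_div_div_cancel_right₀ hn'.ne']
  have hlt : (n - r.den : ℝ) < y := by exact_mod_cast hy.1
  have hle : (y : ℝ) ≤ n := by exact_mod_cast hy.2
  rw [fareyPoint, hphase, suspensionMap_coe_div (div_pos hden hn')]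
  refine ⟨?_, (div_le_one hn').mpr hle⟩
  rwa [one_sub_div hn'.ne', div_lt_div_iff_of_pos_right hn']

lemma fareyPoint_mem_fareyTriangle {n : ℕ} {r : ℚ} (hr : r ∈ fareyFractions n) :
    fareyPoint n r ∈ fareyTriangle := by
  have hrn : (r.den : ℝ) ≤ n := by exact_mod_cast (mem_fareyFractions.mp hr).2.2
  have hden : (0 : ℝ) < r.den := by exact_mod_cast r.pos
  exact suspensionMap_mem_fareyTriangle
    ⟨div_pos hden (hden.trans_le hrn), (div_le_one (hden.trans_le hrn)).mpr hrn⟩ _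

lemma measurePreserving_prod_torus :
    MeasurePreserving (fun x : ℝ × UnitAddTorus (Fin 2) ↦ ((x.1, x.2 0), x.2 1))
      (radialMeasure.prod volume) ((radialMeasure.prod volume).prod volume) :=
  (measurePreserving_prodAssoc radialMeasure volume volume).symm.comp
    ((MeasurePreserving.id radialMeasure).prod (volume_preserving_finTwoArrow UnitAddCircle))

theorem tendsto_empiricalMeasure_fareyPoint :
    Tendsto (fun n : ℕ ↦ empiricalMeasure (fareyFractions n) fun r ↦
        (fareyPoint n r, ((r : ℝ) : UnitAddCircle))) atTop
      (𝓝 (.prod ⟨fareyMeasure, inferInstance⟩ ⟨volume, inferInstance⟩)) := by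
  obtain ⟨U, hU, hUc, hU0⟩ := exists_isOpen_continuousOn_suspensionMap
  have hsplit : Continuous fun x : ℝ × UnitAddTorus (Fin 2) ↦ ((x.1, x.2 0), x.2 1) := by fun_prop
  have hmp := (measurePreserving_suspensionMap.prod (.id volume)).comp measurePreserving_prod_torus
  have hlim := tendsto_empiricalMeasure_prodMk (fun m N ↦ fareyFractions_eq_filter)
    (fun t ht _ ↦ tendsto_card_fareyFractions_floor_div ht) (fun N r _ ↦ r.pos)
    tendsto_empiricalMeasure_fareyTorusPoint
  have hnull : radialMeasure.prod (volume : Measure (UnitAddTorus (Fin 2)))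
      ((fun x ↦ (x.1, x.2 0)) ⁻¹' U)ᶜ = 0 := by
    rw [← Set.preimage_compl, ← hU0]
    exact (measurePreserving_fst.comp measurePreserving_prod_torus).measure_preimage
      hU.measurableSet.compl.nullMeasurableSet
  have hmeas : Measurable (Prod.map suspensionMap id ∘
      fun x : ℝ × UnitAddTorus (Fin 2) ↦ ((x.1, x.2 0), x.2 1)) := hmp.measurable
  have hmap := tendsto_map_of_continuousOn hlim hmeas
    ((hUc.prodMap continuousOn_id).comp hsplit.continuousOn fun x hx ↦ ⟨hx, Set.mem_univ _⟩)
    (hU.preimage hsplit.fst) hnull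
  refine (hmap.congr' ?_).trans_eq (congrArg 𝓝 (Subtype.ext hmp.map_eq))
  filter_upwards [eventually_gt_atTop 0] with n hn
  rw [map_empiricalMeasure (fareyFractions_nonempty hn) hmeas]
  rfl

end FareyPoints

section IntervalAverages

open Finset

lemma continuousAt_indicator_preimage_iocRepr {ξ η : ℝ} {θ : UnitAddCircle} (h0 : θ ≠ 0)
    (hξ : θ ≠ ξ) (hη : θ ≠ η) :
    ContinuousAt ((iocRepr ⁻¹' Set.Ioc ξ η).indicator (1 : UnitAddCircle → ℝ)) θ := by
  have hfrontier : iocRepr θ ∉ frontier (Set.Ioc ξ η) := by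
    rcases lt_or_ge ξ η with hlt | hle
    · rw [frontier_Ioc hlt]
      rintro (h | h)
      · exact hξ (by rw [← h, coe_iocRepr])
      · exact hη (by rw [← h, coe_iocRepr])
    · simp only [Set.Ioc_eq_empty hle.not_gt, frontier_empty, Set.mem_empty_iff_false,
        not_false_eq_true]
  exact (continuousOn_const.continuousAt_indicator hfrontier).comp (continuousAt_iocRepr h0)

lemma volume_real_preimage_iocRepr {ξ η : ℝ} (h0 : 0 ≤ ξ) (h : ξ ≤ η) (h1 : η ≤ 1) :
    (volume : Measure UnitAddCircle).real (iocRepr ⁻¹' Set.Ioc ξ η) = η - ξ := by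
  rw [measurePreserving_iocRepr.measureReal_preimage measurableSet_Ioc.nullMeasurableSet,
    measureReal_restrict_apply measurableSet_Ioc,
    Set.inter_eq_left.mpr (Set.Ioc_subset_Ioc h0 h1), Real.volume_real_Ioc_of_le h]

lemma PiecewiseContinuousOn.exists_isOpen {f : ℝ × ℝ → ℝ}
    (hf : PiecewiseContinuousOn f fareyTriangle) :
    ∃ P : Set (ℝ × ℝ), IsOpen P ∧ P ⊆ fareyTriangle ∧ ContinuousOn f P ∧ fareyMeasure Pᶜ = 0 := by
  obtain ⟨Q, hQo, hQs, -, hQ0, hQc⟩ := hf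
  refine ⟨⋃ i, Q i, isOpen_iUnion hQo, Set.iUnion_subset hQs,
    ContinuousOn.iUnion_of_isOpen hQc hQo, ?_⟩
  rw [fareyMeasure, Measure.smul_apply, Measure.restrict_apply' measurableSet_fareyTriangle,
    Set.inter_comm, ← Set.sdiff_eq, hQ0, smul_zero]

lemma PiecewiseContinuousOn.integrable {f : ℝ × ℝ → ℝ}
    (hf : PiecewiseContinuousOn f fareyTriangle) {C : ℝ} (hC : ∀ x ∈ fareyTriangle, |f x| ≤ C) :
    Integrable f fareyMeasure := by
  obtain ⟨P, hPo, hPs, hPc, hP0⟩ := hf.exists_isOpen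
  have hae : ∀ᵐ x ∂fareyMeasure, x ∈ P := hP0
  refine Integrable.of_bound ?_ C (hae.mono fun x hx ↦ hC x (hPs hx))
  rw [← Measure.restrict_eq_self_of_ae_mem hae]
  exact hPc.aestronglyMeasurable hPo.measurableSet

theorem tendsto_sum_fareyPoint_mul_div {f : ℝ × ℝ → ℝ} (hf : PiecewiseContinuousOn f fareyTriangle)
    {C : ℝ} (hC : ∀ x ∈ fareyTriangle, |f x| ≤ C) {g : UnitAddCircle → ℝ} (hg : ∀ θ, |g θ| ≤ 1)
    {V : Set UnitAddCircle} (hV : IsOpen V) (hgV : ContinuousOn g V) (hV0 : volume Vᶜ = 0) :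
    Tendsto (fun n ↦ (∑ r ∈ fareyFractions n, f (fareyPoint n r) * g (r : ℝ)) / fareyIndex n)
      atTop (𝓝 ((∫ x, f x ∂fareyMeasure) * ∫ θ, g θ)) := by
  obtain ⟨P, hPo, hPs, hPc, hP0⟩ := hf.exists_isOpen
  set F : ℝ × ℝ → ℝ := fareyTriangle.indicator f
  have hFf : ∀ x ∈ fareyTriangle, F x = f x := fun x hx ↦ Set.indicator_of_mem hx f
  have hFbound (x : ℝ × ℝ) : |F x| ≤ |C| := by
    by_cases hx : x ∈ fareyTriangle
    · exact (hFf x hx ▸ hC x hx).trans (le_abs_self C)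
    · simp only [F, Set.indicator_of_notMem hx, abs_zero, abs_nonneg]
  have hbound (x : (ℝ × ℝ) × UnitAddCircle) : |F x.1 * g x.2| ≤ |C| := by
    rw [abs_mul]
    exact (mul_le_of_le_one_right (abs_nonneg _) (hg x.2)).trans (hFbound x.1)
  have hcont : ContinuousOn (fun x : (ℝ × ℝ) × UnitAddCircle ↦ F x.1 * g x.2) (P ×ˢ V) :=
    ((hPc.congr fun x hx ↦ hFf x (hPs hx)).comp continuousOn_fst fun x hx ↦ hx.1).mul
      (hgV.comp continuousOn_snd fun x hx ↦ hx.2)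
  have hnull : fareyMeasure.prod volume (P ×ˢ V)ᶜ = 0 := by
    rw [Set.compl_prod_eq_union, measure_union_null_iff]
    simp only [Measure.prod_prod, hP0, hV0, zero_mul, mul_zero, and_self]
  have hlim := tendsto_integral_of_bounded_of_continuousOn tendsto_empiricalMeasure_fareyPoint
    hbound ((eventually_gt_atTop 0).mono fun n hn ↦
      (integrable_empiricalMeasure (fareyFractions_nonempty hn) _).aestronglyMeasurable)
    hcont (hPo.prod hV) hnull
  have hint : ∫ x, F x.1 * g x.2 ∂fareyMeasure.prod volume =
      (∫ x, f x ∂fareyMeasure) * ∫ θ, g θ := by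
    rw [integral_prod_mul F g]
    congr 1
    exact integral_congr_ae
      ((show ∀ᵐ x ∂fareyMeasure, x ∈ P from hP0).mono fun x hx ↦ hFf x (hPs hx))
  refine (hlim.congr' ?_).trans_eq (congrArg 𝓝 hint)
  filter_upwards [eventually_gt_atTop 0] with n hn
  rw [integral_empiricalMeasure (fareyFractions_nonempty hn), fareyIndex_eq_card hn, smul_eq_mul,
    ← div_eq_inv_mul]
  congr 1
  exact sum_congr rfl fun r hr ↦ by rw [hFf _ (fareyPoint_mem_fareyTriangle hr)]

theorem tendsto_sum_filter_fareyPoint_div {f : ℝ × ℝ → ℝ}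
    (hf : PiecewiseContinuousOn f fareyTriangle) {C : ℝ} (hC : ∀ x ∈ fareyTriangle, |f x| ≤ C)
    {ξ η : ℝ} (h0 : 0 ≤ ξ) (h : ξ ≤ η) (h1 : η ≤ 1) :
    Tendsto (fun n ↦ (∑ r ∈ fareyFractions n with ((r : ℚ) : ℝ) ∈ Set.Ioc ξ η, f (fareyPoint n r)) /
      fareyIndex n) atTop (𝓝 ((η - ξ) * ∫ x, f x ∂fareyMeasure)) := by
  have hmeas : MeasurableSet (iocRepr ⁻¹' Set.Ioc ξ η) :=
    measurePreserving_iocRepr.measurable measurableSet_Ioc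
  have hfinite : ({0, (ξ : UnitAddCircle), (η : UnitAddCircle)} : Set UnitAddCircle).Finite :=
    Set.toFinite _
  have hlim := tendsto_sum_fareyPoint_mul_div hf hC
    (g := (iocRepr ⁻¹' Set.Ioc ξ η).indicator 1) (fun θ ↦ ?_) hfinite.isClosed.isOpen_compl
    (continuousOn_of_forall_continuousAt fun θ hθ ↦ ?_) ?_
  · rw [integral_indicator_one hmeas, volume_real_preimage_iocRepr h0 h h1, mul_comm] at hlim
    refine hlim.congr fun n ↦ ?_
    rw [sum_filter]
    congr 1
    refine sum_congr rfl fun r hr ↦ ?_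
    obtain ⟨hr0, hr1, -⟩ := mem_fareyFractions.mp hr
    have hr' : iocRepr (r : ℝ) = r := iocRepr_coe ⟨by exact_mod_cast hr0, by exact_mod_cast hr1⟩
    have hind : (iocRepr ⁻¹' Set.Ioc ξ η).indicator (1 : UnitAddCircle → ℝ) (r : ℝ) =
        (Set.Ioc ξ η).indicator 1 (r : ℝ) := by
      conv_rhs => rw [← hr']
      exact Set.indicator_comp_right iocRepr (g := 1)
    rw [hind, Set.indicator_apply, Pi.one_apply, mul_ite, mul_one, mul_zero]
  · simpa only [Real.norm_eq_abs, Pi.one_apply, norm_one] using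
      norm_indicator_le_norm_self (s := iocRepr ⁻¹' Set.Ioc ξ η) (1 : UnitAddCircle → ℝ) θ
  · simp only [Set.mem_compl_iff, Set.mem_insert_iff, Set.mem_singleton_iff, not_or] at hθ
    exact continuousAt_indicator_preimage_iocRepr hθ.1 hθ.2.1 hθ.2.2
  · rw [compl_compl]
    exact hfinite.measure_zero _

end IntervalAverages

section UnimodularChains

/-- A sequence of integer vectors `(U i, W i)` each of which forms, together with its successor, a
positively oriented basis of `ℤ²`. -/
def IsUnimodularChain (U W : ℕ → ℤ) : Prop :=
  ∀ i, U i * W (i + 1) - U (i + 1) * W i = 1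

lemma IsUnimodularChain.strictMono_div {U W : ℕ → ℤ} (h : IsUnimodularChain U W)
    (hU : ∀ i, 0 < U i) : StrictMono fun i ↦ (W i / U i : ℚ) := by
  refine strictMono_nat_of_lt_succ fun i ↦ ?_
  rw [div_lt_div_iff₀ (by exact_mod_cast hU i) (by exact_mod_cast hU (i + 1))]
  exact_mod_cast (by linarith [h i] : W i * U (i + 1) < W (i + 1) * U i)

lemma det_eq_one_of_det_eq_one {u w u' w' u'' w'' : ℤ} {a b : ℝ} (h : u * w' - u' * w = 1)
    (h' : u' * w'' - u'' * w' = 1) (hpos : 0 < u * a + w * b) (hpos'' : 0 < u'' * a + w'' * b)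
    (hlt : u * a + w * b < u' * a + w' * b) (hle : u'' * a + w'' * b ≤ u' * a + w' * b) :
    u * w'' - u'' * w = 1 := by
  have hR : (u * w' - u' * w : ℝ) = 1 := by exact_mod_cast h
  have hR' : (u' * w'' - u'' * w' : ℝ) = 1 := by exact_mod_cast h'
  have hsum : ((u * w'' - u'' * w : ℤ) : ℝ) * (u' * a + w' * b) =
      (u * a + w * b) + (u'' * a + w'' * b) := by
    push_cast
    linear_combination (u'' * a + w'' * b) * hR + (u * a + w * b) * hR'
  have hgt : (0 : ℝ) < (u * w'' - u'' * w : ℤ) :=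
    pos_of_mul_pos_left (hsum ▸ add_pos hpos hpos'') (hpos.trans hlt).le
  have hlt2 : ((u * w'' - u'' * w : ℤ) : ℝ) < 2 :=
    lt_of_mul_lt_mul_right (by linarith) (hpos.trans hlt).le
  have hgt0 : 0 < u * w'' - u'' * w := by exact_mod_cast hgt
  have hlt2' : u * w'' - u'' * w < 2 := by exact_mod_cast hlt2
  omega

lemma exists_last_min_Ioo (v : ℕ → ℝ) {i j : ℕ} (hij : i + 1 < j) :
    ∃ m ∈ Set.Ioo i j, (∀ k ∈ Set.Ioo i j, v m ≤ v k) ∧ ∀ k ∈ Set.Ioo m j, v m < v k := by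
  obtain ⟨m, hm, hmin⟩ := (Finset.Ioo i j).exists_min_image
    (fun k ↦ toLex (v k, OrderDual.toDual k)) ⟨i + 1, Finset.mem_Ioo.mpr ⟨i.lt_succ_self, hij⟩⟩
  simp only [Finset.mem_Ioo, Prod.Lex.toLex_le_toLex, OrderDual.toDual_le_toDual] at hm hmin
  refine ⟨m, hm, fun k hk ↦ ?_, fun k hk ↦ ?_⟩
  · exact (hmin k hk).elim le_of_lt fun h ↦ h.1.le
  · exact (hmin k ⟨hm.1.trans hk.1, hk.2⟩).resolve_right fun h ↦ h.2.not_gt hk.1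

-- Splitting `(i, j)` at the last minimum of the form keeps the weak inequality at the right end of
-- the first half and makes the one at the left end of the second half strict.
theorem IsUnimodularChain.det_eq_one {U W : ℕ → ℤ} (h : IsUnimodularChain U W) {a b : ℝ}
    (hpos : ∀ i, 0 < U i * a + W i * b) {i j : ℕ} (hij : i < j)
    (hlt : ∀ m ∈ Set.Ioo i j, U i * a + W i * b < U m * a + W m * b)
    (hle : ∀ m ∈ Set.Ioo i j, U j * a + W j * b ≤ U m * a + W m * b) :
    U i * W j - U j * W i = 1 := by
  induction hd : j - i using Nat.strong_induction_on generalizing i j with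
  | _ d ih =>
    obtain rfl | hij' := (Nat.succ_le_of_lt hij).eq_or_lt
    · exact h i
    obtain ⟨m, ⟨him, hmj⟩, hmin, hlast⟩ := exists_last_min_Ioo (fun k ↦ U k * a + W k * b) hij'
    have hleft : U i * W m - U m * W i = 1 :=
      ih (m - i) (by omega) him (fun k hk ↦ hlt k ⟨hk.1, hk.2.trans hmj⟩)
        (fun k hk ↦ hmin k ⟨hk.1, hk.2.trans hmj⟩) rfl
    have hright : U m * W j - U j * W m = 1 :=
      ih (j - m) (by omega) hmj hlast (fun k hk ↦ hle k ⟨him.trans hk.1, hk.2⟩) rfl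
    exact det_eq_one_of_det_eq_one hleft hright (hpos i) (hpos j) (hlt m ⟨him, hmj⟩)
      (hle m ⟨him, hmj⟩)

end UnimodularChains

section Orbits

lemma bczMap_mem_fareyTriangle {x : ℝ × ℝ} (hx : x ∈ fareyTriangle) : bczMap x ∈ fareyTriangle := by
  obtain ⟨-, -, h3, h4, -⟩ := hx
  have hfloor := Int.floor_le ((1 + x.1) / x.2)
  have hfloor' := Int.lt_floor_add_one ((1 + x.1) / x.2)
  rw [le_div_iff₀ h3] at hfloor
  rw [div_lt_iff₀ h3] at hfloor'
  refine ⟨h3, h4, ?_, ?_, ?_⟩ <;> simp only [bczMap] <;> linarith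

lemma iterate_bczMap_mem_fareyTriangle {x : ℝ × ℝ} (hx : x ∈ fareyTriangle) (i : ℕ) :
    bczMap^[i] x ∈ fareyTriangle :=
  Set.MapsTo.iterate (fun _ ↦ bczMap_mem_fareyTriangle) i hx

lemma iterate_bczMap_snd (x : ℝ × ℝ) (i : ℕ) : (bczMap^[i] x).2 = (bczMap^[i + 1] x).1 := by
  rw [Function.iterate_succ_apply']
  rfl

/-- The integer sequence starting with `u`, `v` that satisfies the three-term recurrence of the
first coordinates `(T^i x).1` along the orbit of `x` under the BCZ map. -/
noncomputable def bczRec (x : ℝ × ℝ) (u v : ℤ) : ℕ → ℤ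
  | 0 => u
  | 1 => v
  | i + 2 => ⌊(1 + (bczMap^[i] x).1) / (bczMap^[i] x).2⌋ * bczRec x u v (i + 1) - bczRec x u v i

lemma isUnimodularChain_bczRec (x : ℝ × ℝ) {u v u' v' : ℤ} (h : u * v' - v * u' = 1) :
    IsUnimodularChain (bczRec x u v) (bczRec x u' v') := by
  intro i
  induction i with
  | zero => exact h
  | succ i ih =>
    simp only [bczRec]
    linear_combination ih

lemma iterate_bczMap_fst_eq {x : ℝ × ℝ} {u v u' v' : ℤ} {a b : ℝ} (h : x.1 = u * a + u' * b)
    (h' : x.2 = v * a + v' * b) (i : ℕ) :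
    (bczMap^[i] x).1 = bczRec x u v i * a + bczRec x u' v' i * b := by
  induction i using Nat.twoStepInduction with
  | zero => exact h
  | one => exact h'
  | more i ih ih' =>
    have hrec : (bczMap^[i + 2] x).1 = ⌊(1 + (bczMap^[i] x).1) / (bczMap^[i] x).2⌋ *
        (bczMap^[i + 1] x).1 - (bczMap^[i] x).1 := by
      rw [← iterate_bczMap_snd x (i + 1), Function.iterate_succ_apply', bczMap, iterate_bczMap_snd]
    simp only [bczRec]
    push_cast
    linear_combination hrec - ih + ⌊(1 + (bczMap^[i] x).1) / (bczMap^[i] x).2⌋ * ih'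

end Orbits

namespace Excursion

lemma point_mem_fareyTriangle (e : Excursion) (i : ℕ) : e.point i ∈ fareyTriangle :=
  iterate_bczMap_mem_fareyTriangle e.start_mem i

lemma fst_lt_point (e : Excursion) {m : ℕ} (hm : m ∈ Set.Ioo 0 e.len) :
    (e.point 0).1 < (e.point m).1 ∧ (e.point e.len).1 < (e.point m).1 :=
  (e.deeper m hm.1 hm.2).imp
    (one_div_lt_one_div (e.point_mem_fareyTriangle m).1 (e.point_mem_fareyTriangle 0).1).mp
    (one_div_lt_one_div (e.point_mem_fareyTriangle m).1 (e.point_mem_fareyTriangle e.len).1).mp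

lemma det_eq_one (e : Excursion) {U W : ℕ → ℤ} (h : IsUnimodularChain U W) {a b : ℝ}
    (hfst : ∀ i, (e.point i).1 = U i * a + W i * b) : U 0 * W e.len - U e.len * W 0 = 1 := by
  refine h.det_eq_one (a := a) (b := b) (fun i ↦ ?_) e.len_pos (fun m hm ↦ ?_) fun m hm ↦ ?_ <;>
    simp only [← hfst]
  exacts [(e.point_mem_fareyTriangle i).1, (e.fst_lt_point hm).1, (e.fst_lt_point hm).2.le]

lemma exists_start_snd_eq (e : Excursion) :
    ∃ k : ℤ, e.start.2 = (e.point e.len).1 + k * e.start.1 := by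
  have hfst : ∀ i, (e.point i).1 = bczRec e.start 1 0 i * e.start.1 +
      bczRec e.start 0 1 i * e.start.2 := iterate_bczMap_fst_eq (by simp) (by simp)
  have hdet := e.det_eq_one (isUnimodularChain_bczRec e.start (by norm_num)) hfst
  have hone : bczRec e.start 0 1 e.len = 1 := by
    simpa only [bczRec, one_mul, mul_zero, sub_zero] using hdet
  refine ⟨-bczRec e.start 1 0 e.len, ?_⟩
  rw [hfst, hone]
  push_cast
  ring

lemma len_le_len {e e' : Excursion} (hstart : e.start = e'.start)
    (hend : (e.point e.len).1 = (e'.point e'.len).1) : e.len ≤ e'.len := by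
  by_contra! hlt
  refine (e.fst_lt_point ⟨e'.len_pos, hlt⟩).2.ne ?_
  rw [hend, point, point, hstart]

lemma eq_of_corresponds {e e' : Excursion} {a b : ℝ} (h : e.Corresponds a b)
    (h' : e'.Corresponds a b) : e = e' := by
  have hend : (e.point e.len).1 = (e'.point e'.len).1 := h.2.trans h'.2.symm
  obtain ⟨k, hk⟩ := e.exists_start_snd_eq
  obtain ⟨k', hk'⟩ := e'.exists_start_snd_eq
  have hfst : e.start.1 = e'.start.1 := h.1.trans h'.1.symm
  have hstart : e.start = e'.start := by
    rw [← hend, ← hfst] at hk'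
    obtain ⟨h0, -, -, h1, h2⟩ := e.start_mem
    obtain ⟨-, -, -, h1', h2'⟩ := e'.start_mem
    have := (existsUnique_add_zsmul_mem_Ioc h0 (e.point e.len).1 (1 - e.start.1)).unique
      (y₁ := k) (y₂ := k')
      (by simp only [zsmul_eq_mul, ← hk]; constructor <;> linarith)
      (by simp only [zsmul_eq_mul, ← hk']; constructor <;> linarith)
    exact Prod.ext hfst (by rw [hk, hk', this])
  exact Excursion.ext hstart ((len_le_len hstart hend).antisymm (len_le_len hstart.symm hend.symm))

end Excursion

namespace IsUnimodularChain

variable {U W : ℕ → ℤ} {a b : ℝ}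

lemma nonneg_of_pos (h : IsUnimodularChain U W) (ha : 0 ≤ a) (hb : 0 ≤ b)
    (hpos : ∀ i, 0 < U i * a + W i * b) {i : ℕ} (hU : 0 < U i) (hW : 0 < W i) :
    0 ≤ U (i + 1) ∧ 0 < W (i + 1) := by
  have hdet := h i
  have hU' : 0 ≤ U (i + 1) := by
    by_contra! hneg
    have hW' : W (i + 1) ≤ 0 := by nlinarith
    have h1 : (U (i + 1) : ℝ) * a ≤ 0 :=
      mul_nonpos_of_nonpos_of_nonneg (by exact_mod_cast hneg.le) ha
    have h2 : (W (i + 1) : ℝ) * b ≤ 0 := mul_nonpos_of_nonpos_of_nonneg (by exact_mod_cast hW') hb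
    linarith [hpos (i + 1)]
  exact ⟨hU', by nlinarith⟩

lemma nonneg_of_forall_pos (h : IsUnimodularChain U W) (ha : 0 ≤ a) (hb : 0 ≤ b)
    (hpos : ∀ i, 0 < U i * a + W i * b) (hU1 : 0 ≤ U 1) (hW1 : 0 < W 1) {i : ℕ}
    (hU : ∀ j ∈ Set.Icc 1 i, 0 < U j) : 0 ≤ U (i + 1) ∧ 0 < W (i + 1) := by
  induction i with
  | zero => exact ⟨hU1, hW1⟩
  | succ i ih =>
    exact h.nonneg_of_pos ha hb hpos (hU _ ⟨by omega, le_rfl⟩)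
      (ih fun j hj ↦ hU j ⟨hj.1, hj.2.trans i.le_succ⟩).2

-- If all vectors were positive, they would be bounded, although their slopes increase.
lemma exists_nonpos (h : IsUnimodularChain U W) (ha : 0 < a) (hb : 0 < b)
    (hle : ∀ i, U i * a + W i * b ≤ 1) (hW : ∀ i, 0 ≤ W i) : ∃ i, U i ≤ 0 := by
  by_contra! hU
  have hinj : Function.Injective fun i ↦ (U i, W i) := fun i j hij ↦
    (h.strictMono_div hU).injective (by
      simp only [Prod.mk.injEq] at hij
      simp only [hij])
  refine (Set.finite_Icc ((0, 0) : ℤ × ℤ) (⌊1 / a⌋, ⌊1 / b⌋)).not_infinite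
    ((Set.infinite_range_of_injective hinj).mono ?_)
  rintro - ⟨i, rfl⟩
  have hUa : 0 ≤ U i * a := mul_nonneg (by exact_mod_cast (hU i).le) ha.le
  have hWb : 0 ≤ W i * b := mul_nonneg (by exact_mod_cast hW i) hb.le
  refine ⟨⟨(hU i).le, hW i⟩, Int.le_floor.mpr ?_, Int.le_floor.mpr ?_⟩
  · exact (le_div_iff₀ ha).mpr (by linarith [hle i])
  · exact (le_div_iff₀ hb).mpr (by linarith [hle i])

lemma exists_eq_zero_one (h : IsUnimodularChain U W) (ha : 0 < a) (hb : 0 < b)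
    (hpos : ∀ i, 0 < U i * a + W i * b) (hle : ∀ i, U i * a + W i * b ≤ 1) (hU0 : 0 < U 0)
    (hW0 : 0 ≤ W 0) (hU1 : 0 ≤ U 1) (hW1 : 0 < W 1) :
    ∃ s, 0 < s ∧ U s = 0 ∧ W s = 1 ∧ ∀ m ∈ Set.Ioo 0 s, 0 < U m ∧ 0 < W m := by
  classical
  have hnonneg {i : ℕ} := h.nonneg_of_forall_pos ha.le hb.le hpos hU1 hW1 (i := i)
  have hexists : ∃ i, U i ≤ 0 := by
    by_contra! hU
    refine (h.exists_nonpos ha hb hle fun i ↦ ?_).elim fun i hi ↦ (hU i).not_ge hi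
    cases i with
    | zero => exact hW0
    | succ i => exact (hnonneg fun j _ ↦ hU j).2.le
  have hlt {j : ℕ} (hj : j < Nat.find hexists) : 0 < U j := not_le.mp (Nat.find_min hexists hj)
  obtain ⟨s, hs⟩ : ∃ s, Nat.find hexists = s + 1 :=
    Nat.exists_eq_succ_of_ne_zero fun h0 ↦ (h0 ▸ Nat.find_spec hexists).not_gt hU0
  have hUW {i : ℕ} (hi : i < s + 1) : 0 ≤ U (i + 1) ∧ 0 < W (i + 1) :=
    hnonneg fun j hj ↦ hlt (hs ▸ hj.2.trans_lt hi)
  have hUs : U (s + 1) = 0 := (hs ▸ Nat.find_spec hexists).antisymm (hUW s.lt_succ_self).1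
  have hWs : W (s + 1) = 1 := by
    have hdet := h s
    rw [hUs, zero_mul, sub_zero] at hdet
    exact Int.eq_one_of_mul_eq_one_left (hUW s.lt_succ_self).2.le hdet
  refine ⟨s + 1, s.succ_pos, hUs, hWs, fun m hm ↦ ⟨hlt (hs ▸ hm.2), ?_⟩⟩
  obtain ⟨m, rfl⟩ := Nat.exists_eq_succ_of_ne_zero hm.1.ne'
  exact (hUW (m.lt_succ_self.trans hm.2)).2

end IsUnimodularChain

namespace Excursion

theorem exists_corresponds {a b : ℝ} (ha : a ∈ Set.Ioc 0 1) (hb : b ∈ Set.Ioc 0 1) :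
    ∃ e : Excursion, e.Corresponds a b := by
  obtain ⟨k, ⟨hk, hk'⟩, -⟩ := existsUnique_add_zsmul_mem_Ioc ha.1 b (1 - a)
  rw [zsmul_eq_mul] at hk hk'
  rw [sub_add_cancel] at hk'
  have hk0 : 0 ≤ k := by
    by_contra! hneg
    have : (k : ℝ) ≤ -1 := by exact_mod_cast Int.le_sub_one_of_lt hneg
    nlinarith [ha.1, hb.2]
  set x : ℝ × ℝ := (a, b + k * a)
  have hx : x ∈ fareyTriangle := ⟨ha.1, ha.2, by linarith [ha.2], hk', by linarith⟩
  have hmem (i : ℕ) := iterate_bczMap_mem_fareyTriangle hx i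
  have hfst (i : ℕ) : (bczMap^[i] x).1 = bczRec x 1 k i * a + bczRec x 0 1 i * b :=
    iterate_bczMap_fst_eq (by simp [x]) (by simp [x, add_comm]) i
  obtain ⟨s, hs, hUs, hWs, hUW⟩ := (isUnimodularChain_bczRec x (u := 1) (v := k) (u' := 0) (v' := 1)
    (by ring)).exists_eq_zero_one ha.1 hb.1 (fun i ↦ hfst i ▸ (hmem i).1)
    (fun i ↦ hfst i ▸ (hmem i).2.1) one_pos le_rfl hk0 one_pos
  have hend : (bczMap^[s] x).1 = b := by rw [hfst, hUs, hWs, Int.cast_zero, Int.cast_one]; ring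
  refine ⟨⟨x, s, hx, hs, fun m hm hms ↦ ?_⟩, rfl, hend⟩
  obtain ⟨hU, hW⟩ := hUW m ⟨hm, hms⟩
  have hU' : (1 : ℝ) ≤ bczRec x 1 k m := by exact_mod_cast hU
  have hW' : (1 : ℝ) ≤ bczRec x 0 1 m := by exact_mod_cast hW
  have hfst_m : (bczMap^[m] x).1 ≥ a + b := by
    rw [hfst]
    nlinarith [ha.1, hb.1]
  rw [hend]
  exact ⟨one_div_lt_one_div_of_lt ha.1 (by linarith [hb.1]),
    one_div_lt_one_div_of_lt hb.1 (by linarith [ha.1])⟩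

theorem existsUnique_corresponds {a b : ℝ} (ha : a ∈ Set.Ioc 0 1) (hb : b ∈ Set.Ioc 0 1) :
    ∃! e : Excursion, e.Corresponds a b :=
  existsUnique_of_exists_of_unique (exists_corresponds ha hb) fun _ _ ↦ eq_of_corresponds

end Excursion

section FareyChains

open Finset

lemma add_le_den_of_mem_Ioo {u w u' w' : ℤ} (hu : 0 < u) (hu' : 0 < u')
    (h : u * w' - u' * w = 1) {r : ℚ} (hr : r ∈ Set.Ioo (w / u : ℚ) (w' / u')) :
    u + u' ≤ r.den := by
  have hden : (0 : ℚ) < r.den := by exact_mod_cast r.pos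
  obtain ⟨h1, h2⟩ := hr
  rw [← r.num_div_den, div_lt_div_iff₀ (by exact_mod_cast hu) hden] at h1
  rw [← r.num_div_den, div_lt_div_iff₀ hden (by exact_mod_cast hu')] at h2
  have h1' : w * r.den + 1 ≤ r.num * u := by exact_mod_cast h1
  have h2' : r.num * u' + 1 ≤ w' * r.den := by exact_mod_cast h2
  calc u + u' ≤ u * (w' * r.den - r.num * u') + u' * (r.num * u - w * r.den) := by nlinarith
    _ = (u * w' - u' * w) * r.den := by ring
    _ = r.den := by rw [h, one_mul]

namespace IsUnimodularChain

variable {U W : ℕ → ℤ}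

lemma coprime (h : IsUnimodularChain U W) (i : ℕ) : (W i).natAbs.Coprime (U i).natAbs :=
  Int.isCoprime_iff_gcd_eq_one.mp ⟨-U (i + 1), W (i + 1), by linear_combination h i⟩

lemma num_div (h : IsUnimodularChain U W) {i : ℕ} (hU : 0 < U i) : (W i / U i : ℚ).num = W i :=
  Rat.num_div_eq_of_coprime hU (h.coprime i)

lemma den_div (h : IsUnimodularChain U W) {i : ℕ} (hU : 0 < U i) :
    ((W i / U i : ℚ).den : ℤ) = U i :=
  Rat.den_div_eq_of_coprime hU (h.coprime i)

lemma exists_div_eq (h : IsUnimodularChain U W) (hU : ∀ i, 0 < U i) {s : ℕ} {r : ℚ}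
    (hr : r ∈ Set.Ioc (W 0 / U 0 : ℚ) (W s / U s)) (hden : ∀ i, r.den < U i + U (i + 1)) :
    ∃ i ∈ Set.Ioc 0 s, (W i / U i : ℚ) = r := by
  have hexists : ∃ i, r ≤ W i / U i := ⟨s, hr.2⟩
  obtain ⟨i, hi⟩ : ∃ i, Nat.find hexists = i + 1 :=
    Nat.exists_eq_succ_of_ne_zero fun h0 ↦ (h0 ▸ Nat.find_spec hexists).not_gt hr.1
  have hlt : (W i / U i : ℚ) < r := not_le.mp (Nat.find_min hexists (by omega))
  refine ⟨i + 1, ⟨i.succ_pos, hi ▸ Nat.find_min' hexists hr.2⟩, ?_⟩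
  refine (hi ▸ Nat.find_spec hexists).antisymm' (not_lt.mp fun hgt ↦ ?_)
  exact (add_le_den_of_mem_Ioo (hU i) (hU (i + 1)) (h i) ⟨hlt, hgt⟩).not_gt (hden i)

theorem filter_fareyFractions_eq_image (h : IsUnimodularChain U W) {n s : ℕ}
    (hU : ∀ i, U i ∈ Set.Ioc 0 (n : ℤ)) (hadd : ∀ i, n < U i + U (i + 1)) (h0 : 0 ≤ W 0)
    (hs : W s ≤ U s) :
    {r ∈ fareyFractions n | r ∈ Set.Ioc (W 0 / U 0 : ℚ) (W s / U s)} =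
      (Ioc 0 s).image fun i ↦ (W i / U i : ℚ) := by
  have hpos (i : ℕ) : 0 < U i := (hU i).1
  have hmono := h.strictMono_div hpos
  ext r
  simp only [mem_filter, mem_image, mem_fareyFractions, mem_Ioc]
  constructor
  · rintro ⟨⟨-, -, hden⟩, hr⟩
    exact h.exists_div_eq hpos hr fun i ↦ (Int.ofNat_le.mpr hden).trans_lt (hadd i)
  · rintro ⟨i, ⟨hi0, his⟩, rfl⟩
    have hgt : (W 0 / U 0 : ℚ) < W i / U i := hmono hi0
    have hle : (W i / U i : ℚ) ≤ W s / U s := hmono.monotone his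
    refine ⟨⟨?_, ?_, ?_⟩, hgt, hle⟩
    · exact (div_nonneg (by exact_mod_cast h0) (by exact_mod_cast (hpos 0).le)).trans_lt hgt
    · exact hle.trans ((div_le_one (by exact_mod_cast hpos s)).mpr (by exact_mod_cast hs))
    · exact_mod_cast (h.den_div (hpos i)).trans_le (hU i).2

lemma fareyPoint_div (h : IsUnimodularChain U W) {n i : ℕ} (hU : U i ∈ Set.Ioc 0 (n : ℤ))
    (hU' : U (i + 1) ∈ Set.Ioc (n - U i) (n : ℤ)) :
    fareyPoint n (W i / U i) = ((U i / n, U (i + 1) / n) : ℝ × ℝ) := by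
  have hden := h.den_div hU.1
  rw [fareyPoint_eq (y := U (i + 1)) (by exact_mod_cast hU.1.trans_le hU.2) _ (by rwa [hden]),
    ← Int.cast_natCast, hden]
  rw [hden, h.num_div hU.1]
  exact ⟨W (i + 1), by linear_combination -h i⟩

end IsUnimodularChain

namespace Excursion

lemma exists_isUnimodularChain (e : Excursion) {n : ℕ} {p q x y : ℤ} (hdet : y * q - x * p = 1)
    (he : e.Corresponds (q / n) (p / n)) :
    ∃ A N : ℕ → ℤ, IsUnimodularChain A N ∧ A 0 = q ∧ N 0 = x ∧ A e.len = p ∧ N e.len = y ∧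
      ∀ i, (e.point i).1 = A i / n := by
  obtain ⟨k, hk⟩ := e.exists_start_snd_eq
  have hstart : e.start.1 = q / n := he.1
  rw [hstart, he.2] at hk
  have hn : (n : ℝ) ≠ 0 := by
    rintro h0
    exact e.start_mem.1.ne' (by rw [hstart, h0, div_zero])
  set A := bczRec e.start q (p + k * q)
  set N := bczRec e.start x (y + k * x)
  have hchain : IsUnimodularChain A N := isUnimodularChain_bczRec _ (by linear_combination hdet)
  have hfst (i : ℕ) : (e.point i).1 = A i * (n : ℝ)⁻¹ + N i * 0 :=
    iterate_bczMap_fst_eq (by rw [hstart]; ring) (by rw [hk]; push_cast; ring) i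
  have hAlen : A e.len = p := by
    have h := (hfst e.len).symm.trans he.2
    rw [mul_zero, add_zero, ← div_eq_mul_inv, div_left_inj' hn] at h
    exact_mod_cast h
  have hNlen : N e.len = y := by
    have h : q * N e.len - A e.len * x = 1 := e.det_eq_one hchain hfst
    have hq : q ≠ 0 := by
      rintro rfl
      exact e.start_mem.1.ne' (by rw [hstart, Int.cast_zero, zero_div])
    exact mul_left_cancel₀ hq (by linear_combination h + x * hAlen - hdet)
  exact ⟨A, N, hchain, rfl, rfl, hAlen, hNlen, fun i ↦ by
    rw [hfst, mul_zero, add_zero, div_eq_mul_inv]⟩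

lemma point_eq_of_fst_eq (e : Excursion) {A : ℕ → ℤ} {n : ℕ}
    (hfst : ∀ i, (e.point i).1 = A i / n) (i : ℕ) :
    e.point i = ((A i / n, A (i + 1) / n) : ℝ × ℝ) :=
  Prod.ext (hfst i) ((iterate_bczMap_snd e.start i).trans (hfst (i + 1)))

lemma mem_Ioc_of_fst_eq (e : Excursion) {A : ℕ → ℤ} {n : ℕ}
    (hfst : ∀ i, (e.point i).1 = A i / n) (i : ℕ) :
    A i ∈ Set.Ioc 0 (n : ℤ) ∧ A (i + 1) ∈ Set.Ioc (n - A i) (n : ℤ) := by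
  obtain ⟨h1, h2, -, h3, h4⟩ := e.point_eq_of_fst_eq hfst i ▸ e.point_mem_fareyTriangle i
  have hn : (0 : ℝ) < n := n.cast_nonneg.lt_of_ne fun h0 ↦ h1.ne' (by simp only [← h0, div_zero])
  simp only [← add_div, div_pos_iff_of_pos_right hn, div_le_one hn, one_lt_div hn] at h1 h2 h3 h4
  norm_cast at h1 h2 h3 h4
  exact ⟨⟨h1, h2⟩, by linarith, h3⟩

theorem sum_eq (e : Excursion) {n : ℕ} {p q x y : ℤ} (hdet : y * q - x * p = 1) (hx : 0 ≤ x)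
    (hy : y ≤ p) (he : e.Corresponds (q / n) (p / n)) (f : ℝ × ℝ → ℝ) :
    e.sum f = f e.start +
      ∑ r ∈ fareyFractions n with ((r : ℚ) : ℝ) ∈ Set.Ioc (x / q : ℝ) (y / p),
        f (fareyPoint n r) := by
  obtain ⟨A, N, hchain, hA0, hN0, hAs, hNs, hfst⟩ := e.exists_isUnimodularChain hdet he
  have hmem := e.mem_Ioc_of_fst_eq hfst
  have himage := hchain.filter_fareyFractions_eq_image (s := e.len) (fun i ↦ (hmem i).1)
    (fun i ↦ sub_lt_iff_lt_add'.mp (hmem i).2.1) (hN0 ▸ hx) (by rwa [hNs, hAs])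
  rw [hA0, hN0, hAs, hNs] at himage
  have hcast (r : ℚ) : (r : ℝ) ∈ Set.Ioc (x / q : ℝ) (y / p) ↔ r ∈ Set.Ioc (x / q : ℚ) (y / p) := by
    simp only [Set.mem_Ioc]
    norm_cast
  simp only [hcast]
  rw [himage, sum_image (hchain.strictMono_div fun i ↦ (hmem i).1.1).injective.injOn,
    Excursion.sum, range_eq_Ico, sum_eq_sum_Ico_succ_bot e.len.succ_pos]
  refine congrArg₂ _ rfl (sum_congr (by ext; simp only [mem_Ico, mem_Ioc]; omega) fun i _ ↦ ?_)
  rw [hchain.fareyPoint_div (hmem i).1 (hmem i).2, e.point_eq_of_fst_eq hfst]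

end Excursion

end FareyChains

section Asymptotics

lemma exists_det_eq_one_of_coprime {p q : ℕ} (hp : 0 < p) (hq : 0 < q) (h : p.Coprime q) :
    ∃ x y : ℤ, 0 ≤ x ∧ y ≤ p ∧ y * q - x * p = 1 := by
  obtain ⟨u, v, huv⟩ := Nat.isCoprime_iff_coprime.mpr h
  obtain ⟨m, ⟨hm, hm'⟩, -⟩ := existsUnique_add_zsmul_mem_Ioc (Int.natCast_pos.mpr hp) v 0
  rw [smul_eq_mul] at hm hm'
  have hdet : (v + m * p) * q - (m * q - u) * p = 1 := by linear_combination huv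
  exact ⟨m * q - u, v + m * p, by nlinarith, by rwa [zero_add] at hm', hdet⟩

lemma tendsto_fareyIndex_atTop : Tendsto (fun n ↦ (fareyIndex n : ℝ)) atTop atTop := by
  have hsq : Tendsto (fun n : ℕ ↦ (n : ℝ) ^ 2) atTop atTop :=
    (tendsto_pow_atTop two_ne_zero).comp tendsto_natCast_atTop_atTop
  refine (tendsto_card_fareyFractions_div_sq.pos_mul_atTop (by positivity) hsq).congr' ?_
  filter_upwards [eventually_gt_atTop 0] with n hn
  rw [fareyIndex_eq_card hn, div_mul_cancel₀ _ (by positivity)]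

theorem Excursion.tendsto_sum_div {f : ℝ × ℝ → ℝ} (hf : PiecewiseContinuousOn f fareyTriangle)
    {C : ℝ} (hC : ∀ x ∈ fareyTriangle, |f x| ≤ C) {p q x y : ℤ} (hp : 0 < p) (hq : 0 < q)
    (hdet : y * q - x * p = 1) (hx : 0 ≤ x) (hy : y ≤ p) {e : ℕ → Excursion}
    (he : ∀ᶠ n : ℕ in atTop, (e n).Corresponds (q / n) (p / n)) :
    Tendsto (fun n ↦ (e n).sum f / fareyIndex n) atTop
      (𝓝 ((1 / (p * q)) * ∫ x, f x ∂fareyMeasure)) := by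
  have hp' : (0 : ℝ) < p := by exact_mod_cast hp
  have hq' : (0 : ℝ) < q := by exact_mod_cast hq
  have hlen : (y / p - x / q : ℝ) = 1 / (p * q) := by
    rw [div_sub_div _ _ hp'.ne' hq'.ne', mul_comm (p : ℝ) x]
    congr 1
    exact_mod_cast hdet
  have hstart : Tendsto (fun n ↦ f (e n).start / fareyIndex n) atTop (𝓝 0) :=
    tendsto_bdd_div_atTop_nhds_zero
      (.of_forall fun n ↦ (abs_le.mp (hC _ (e n).start_mem)).1)
      (.of_forall fun n ↦ (abs_le.mp (hC _ (e n).start_mem)).2) tendsto_fareyIndex_atTop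
  have hmain := tendsto_sum_filter_fareyPoint_div hf hC (ξ := x / q) (η := y / p)
    (by positivity) (by rw [← sub_nonneg, hlen]; positivity)
    ((div_le_one hp').mpr (by exact_mod_cast hy))
  rw [hlen] at hmain
  refine (zero_add (1 / (p * q) * ∫ x, f x ∂fareyMeasure) ▸ hstart.add hmain).congr' ?_
  filter_upwards [he] with n hn
  rw [(e n).sum_eq hdet hx hy hn, add_div]

end Asymptotics

theorem theorem4p6 (f : ℝ × ℝ → ℝ)
    (hf : PiecewiseContinuousOn f fareyTriangle)
    (hbdd : ∃ C : ℝ, ∀ x ∈ fareyTriangle, |f x| ≤ C)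
    (p q : ℕ) (hp : 0 < p) (hq : 0 < q) (hpq : Nat.Coprime p q) :
    (∀ n : ℕ, max p q ≤ n →
      ∃! e : Excursion, e.Corresponds ((q : ℝ) / (n : ℝ)) ((p : ℝ) / (n : ℝ))) ∧
    Integrable f fareyMeasure ∧
    ∀ e : ℕ → Excursion,
      (∀ n : ℕ, max p q ≤ n → (e n).Corresponds ((q : ℝ) / (n : ℝ)) ((p : ℝ) / (n : ℝ))) →
      Tendsto (fun n : ℕ => ((p : ℝ) * (q : ℝ) / (fareyIndex n : ℝ)) * (e n).sum f) atTop
        (𝓝 (∫ x, f x ∂fareyMeasure)) := by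
  obtain ⟨C, hC⟩ := hbdd
  have hmem {k n : ℕ} (hk : 0 < k) (hkn : k ≤ n) : (k / n : ℝ) ∈ Set.Ioc 0 1 :=
    have hn : (0 : ℝ) < n := by exact_mod_cast hk.trans_le hkn
    ⟨by positivity, (div_le_one hn).mpr (by exact_mod_cast hkn)⟩
  refine ⟨fun n hn ↦ Excursion.existsUnique_corresponds (hmem hq (le_of_max_le_right hn))
    (hmem hp (le_of_max_le_left hn)), hf.integrable hC, fun e he ↦ ?_⟩
  obtain ⟨x, y, hx, hy, hdet⟩ := exists_det_eq_one_of_coprime hp hq hpq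
  have hlim := Excursion.tendsto_sum_div hf hC (Int.natCast_pos.mpr hp) (Int.natCast_pos.mpr hq)
    hdet hx hy (e := e) (eventually_atTop.mpr ⟨max p q, by simpa only [Int.cast_natCast] using he⟩)
  convert! hlim.const_mul (p * q : ℝ) using 2
  · ring
  · push_cast
    field_simp
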